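/- Conventions. A monoidal model category is a model category $\mathcal C$ with a closed symmetric monoidal structure $(\otimes,\mathbb I)$ satisfying two axioms. (Pushout product axiom) For cofibrations $A\to B$ and $K\to L$ the map $A\otimes L\amalg_{A\otimes K}B\otimes K\to B\otimes L$ is a cofibration, and it is a weak equivalence if moreover one of the two given maps is. (Unit axiom) For every cofibrant replacement $q\colon\mathbb I^c\to\mathbb I$ (a weak equivalence from a cofibrant object) and every cofibrant $A$, the map $q\otimes A\colon \mathbb I^c\otimes A\to\mathbb I\otimes A$ is a weak equivalence. A cosimplicial resolution of an object $A$ of a model category is a Reedy cofibrant cosimplicial object $A^*$ (all latching maps are cofibrations) with a levelwise weak equivalence from $A^*$ to the constant cosimplicial object $A$; for an object $Y$, $\mathrm{map}(A^*,Y)$ is the simplicial set with $n$-simplices the morphisms $A^n\to Y$. The object $A$ detects weak equivalences if, for some (hence any) cosimplicial resolution $A^*$ of $A$, a morphism $f\colon Y\to Z$ between fibrant objects is a weak equivalence if and only if $\mathrm{map}(A^*,f)$ is a weak equivalence of simplicial sets. Let $\mathcal C=(\mathcal C,\otimes,\mathbb I_{\mathcal C})$ and $\mathcal D=(\mathcal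 D,\wedge,\mathbb I_{\mathcal D})$ be monoidal model categories, and let $\lambda\colon\mathcal D\rightleftarrows\mathcal C\colon R$ be a Quillen adjoint pair ($\lambda$ is left adjoint to $R$, and $R$ preserves fibrations and trivial fibrations), together with a lax monoidal structure $\varphi_{X,Y}\colon RX\wedge RY\to R(X\otimes Y)$, $\nu\colon\mathbb I_{\mathcal D}\to R(\mathbb I_{\mathcal C})$ on $R$. Write $\tilde\nu\colon\lambda(\mathbb I_{\mathcal D})\to\mathbb I_{\mathcal C}$ for the adjoint of $\nu$, and $\tilde\varphi\colon\lambda(A\wedge B)\to\lambda A\otimes\lambda B$ for the adjoint of the composite of $\eta_A\wedge\eta_B\colon A\wedge B\to R\lambda A\wedge R\lambda B$ with $\varphi_{\lambda A,\lambda B}$, where $\eta$ is the unit of the adjunction. Proposition. Suppose that 1. for some (hence any) cofibrant replacement $q\colon\mathbb I_{\mathcal D}^c\to\mathbb I_{\mathcal D}$ of the unit object of $\mathcal D$, the composite $\lambda(\mathbb I_{\mathcal D}^c)\xrightarrow{\lambda(q)}\lambda(\mathbb I_{\mathcal D})\xrightarrow{\tilde\nu}\mathbb I_{\mathcal C}$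 is a weak equivalence in $\mathcal C$; 2. the unit object $\mathbb I_{\mathcal D}$ detects weak equivalences in $\mathcal D$. Then $\lambda$ and $R$ form a weak monoidal Quillen pair: for all cofibrant objects $A$ and $B$ of $\mathcal D$ the map $\tilde\varphi\colon\lambda(A\wedge B)\to\lambda A\otimes\lambda B$ is a weak equivalence in $\mathcal C$, and for every cofibrant replacement $q\colon\mathbb I_{\mathcal D}^c\to\mathbb I_{\mathcal D}$ the composite $\tilde\nu\circ\lambda(q)\colon\lambda(\mathbb I_{\mathcal D}^c)\to\mathbb I_{\mathcal C}$ is a weak equivalence in $\mathcal C$. -/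

import Mathlib

open CategoryTheory Limits MonoidalCategory HomotopicalAlgebra Simplicial

universe v v₁ v₂ u u₁ u₂

namespace MonoidalQuillen

/-! ### Weak equivalences of simplicial sets -/

/-- The set of simplicial homotopy classes of maps `X ⟶ K`, i.e. the set of connected components
of the simplicial function complex from `X` to `K`. -/
def HomotopyClasses (X K : SSet.{v}) : Type v :=
  Quot (fun f g : X ⟶ K => Nonempty (SSet.Homotopy f g))

/-- Simplicial homotopies can be precomposed with a map of simplicial sets. -/
theorem homotopy_precomp {X Y K : SSet.{v}} (f : X ⟶ Y) {g h : Y ⟶ K}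
    (H : Nonempty (SSet.Homotopy g h)) : Nonempty (SSet.Homotopy (f ≫ g) (f ≫ h)) := by
  obtain ⟨H⟩ := H
  have e₀ : (SSet.ι₀ : X ⟶ X ⊗ Δ[1]) ≫ f ▷ Δ[1] = f ≫ SSet.ι₀ := rfl
  have e₁ : (SSet.ι₁ : X ⟶ X ⊗ Δ[1]) ≫ f ▷ Δ[1] = f ≫ SSet.ι₁ := rfl
  refine ⟨{ h := f ▷ Δ[1] ≫ H.h, h₀ := ?_, h₁ := ?_, rel := ?_ }⟩
  · rw [← Category.assoc, e₀, Category.assoc, H.h₀]; rfl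
  · rw [← Category.assoc, e₁, Category.assoc, H.h₁]; rfl
  · ext n ⟨⟨x, hx⟩, y⟩
    exact hx.elim

/-- The map on homotopy classes of maps to `K` induced by precomposition with `f : X ⟶ Y`. -/
def HomotopyClasses.precomp {X Y : SSet.{v}} (f : X ⟶ Y) (K : SSet.{v}) :
    HomotopyClasses Y K → HomotopyClasses X K :=
  Quot.map (fun g => f ≫ g) (fun _ _ H => homotopy_precomp f H)

/-- A map `f : X ⟶ Y` of simplicial sets is a weak (homotopy) equivalence if for every
Kan complex `K`, it induces a bijection between the simplicial homotopy classes of maps `Y ⟶ K`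
and the simplicial homotopy classes of maps `X ⟶ K`. -/
def IsWeakEquivalence {X Y : SSet.{v}} (f : X ⟶ Y) : Prop :=
  ∀ (K : SSet.{v}) [SSet.KanComplex K], Function.Bijective (HomotopyClasses.precomp f K)

/-! ### Latching objects and Reedy cofibrant cosimplicial objects -/

/-- The objects of the `n`-th latching category: the injective maps `⦋m⦌ ⟶ ⦋n⦌` that
are not isomorphisms. -/
def latchingProperty (n : ℕ) : ObjectProperty (Over ⦋n⦌) :=
  fun f => Mono f.hom ∧ ¬ IsIso f.hom

/-- The `n`-th latching category of the simplex category. -/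
abbrev LatchingCategory (n : ℕ) := (latchingProperty n).FullSubcategory

instance instFiniteLatchingCategory (n : ℕ) : Finite (LatchingCategory n) := by
  have hlen (f : LatchingCategory n) : f.obj.left.len < n + 1 := by
    have := f.property.1
    exact Nat.lt_succ_of_le (SimplexCategory.len_le_of_mono f.obj.hom)
  let φ : LatchingCategory n → Σ m : Fin (n + 1), (Fin (m.1 + 1) → Fin (n + 1)) :=
    fun f => ⟨⟨f.obj.left.len, hlen f⟩, fun i => f.obj.hom.toOrderHom i⟩
  refine Finite.of_injective φ ?_
  rintro ⟨⟨X, ⟨⟨⟩⟩, f⟩, hf⟩ ⟨⟨Y, ⟨⟨⟩⟩, g⟩, hg⟩ h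
  induction X using SimplexCategory.rec with | _ a
  induction Y using SimplexCategory.rec with | _ b
  simp only [φ, Sigma.mk.injEq, Fin.mk.injEq] at h
  obtain ⟨h₁, h₂⟩ := h
  obtain rfl : a = b := h₁
  have h₃ : f = g := by
    apply SimplexCategory.Hom.ext
    ext i : 2
    exact congrFun (eq_of_heq h₂) i
  subst h₃
  rfl

noncomputable instance instFinCategoryLatchingCategory (n : ℕ) :
    FinCategory (LatchingCategory n) where
  fintypeObj := Fintype.ofFinite _
  fintypeHom X Y := by
    have : Finite (X ⟶ Y) :=
      Finite.of_injective
        (fun k : X ⟶ Y => (fun i => k.hom.left.toOrderHom i :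
          Fin (X.obj.left.len + 1) → Fin (Y.obj.left.len + 1))) (by
        intro k l h
        apply ObjectProperty.hom_ext
        apply Over.OverMorphism.ext
        apply SimplexCategory.Hom.ext
        ext i : 2
        exact congrFun h i)
    exact Fintype.ofFinite _

section Reedy

variable {C : Type u} [Category.{v} C]

/-- The diagram `(⦋m⦌ ⟶ ⦋n⦌) ↦ X^m` on the `n`-th latching category. -/
abbrev latchingDiagram (X : CosimplicialObject C) (n : ℕ) : LatchingCategory n ⥤ C :=
  (latchingProperty n).ι ⋙ Over.forget _ ⋙ X

/-- The cocone over the latching diagram with point `X^n`, given by the structure maps of `X`. -/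
def latchingCocone (X : CosimplicialObject C) (n : ℕ) : Cocone (latchingDiagram X n) where
  pt := X.obj ⦋n⦌
  ι :=
    { app := fun f => X.map f.obj.hom
      naturality := fun f g k => by
        have h : X.map k.hom.left ≫ X.map g.obj.hom = X.map f.obj.hom := by
          rw [← X.map_comp, Over.w]
        exact h.trans (Category.comp_id _).symm }

/-- The `n`-th latching object of a cosimplicial object. -/
noncomputable def latchingObj [HasFiniteColimits C] (X : CosimplicialObject C) (n : ℕ) : C :=
  colimit (latchingDiagram X n)

/-- The `n`-th latching map of a cosimplicial object. -/
noncomputable def latchingMap [HasFiniteColimits C] (X : CosimplicialObject C) (n : ℕ) :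
    latchingObj X n ⟶ X.obj ⦋n⦌ :=
  colimit.desc (latchingDiagram X n) (latchingCocone X n)

variable [ModelCategory C]

/-- A cosimplicial object is Reedy cofibrant if all its latching maps are cofibrations. -/
def IsReedyCofibrant (X : CosimplicialObject C) : Prop :=
  ∀ n : ℕ, Cofibration (latchingMap X n)

/-- A cosimplicial resolution of `A`: a Reedy cofibrant cosimplicial object together with
a levelwise weak equivalence to the constant cosimplicial object with value `A`. -/
structure IsCosimplicialResolution {A : C} (Q : CosimplicialObject C)
    (p : Q ⟶ (CosimplicialObject.const C).obj A) : Prop where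
  reedyCofibrant : IsReedyCofibrant Q
  weakEquivalence (n : ℕ) : WeakEquivalence (p.app ⦋n⦌)

end Reedy

section Mapping

variable {C : Type u} [Category.{v} C]

/-- The mapping space `map(Q, Y)`, with set of `n`-simplices `C(Q^n, Y)`. -/
def mappingSpace (Q : CosimplicialObject C) (Y : C) : SSet.{v} :=
  Q.op ⋙ yoneda.obj Y

/-- The map `map(Q, f) : map(Q, Y) ⟶ map(Q, Z)` given by postcomposition with `f`. -/
def mappingSpaceMap (Q : CosimplicialObject C) {Y Z : C} (f : Y ⟶ Z) :
    mappingSpace Q Y ⟶ mappingSpace Q Z :=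
  Functor.whiskerLeft Q.op (yoneda.map f)

/-- An object `A` of a model category detects weak equivalences if, for some cosimplicial
resolution `Q` of `A`, a morphism `f` between fibrant objects is a weak equivalence if and
only if `map(Q, f)` is a weak equivalence of simplicial sets. -/
def DetectsWeakEquivalences [ModelCategory C] (A : C) : Prop :=
  ∃ (Q : CosimplicialObject C) (p : Q ⟶ (CosimplicialObject.const C).obj A),
    IsCosimplicialResolution Q p ∧
      ∀ ⦃Y Z : C⦄ [IsFibrant Y] [IsFibrant Z] (f : Y ⟶ Z),
        WeakEquivalence f ↔ IsWeakEquivalence (mappingSpaceMap Q f)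

end Mapping

/-! ### Monoidal model categories and Quillen pairs -/

/-- A morphism `q : Q ⟶ A` is a cofibrant replacement of `A` if `Q` is cofibrant and
`q` is a weak equivalence. -/
structure IsCofibrantReplacement {C : Type u} [Category.{v} C] [ModelCategory C]
    {Q A : C} (q : Q ⟶ A) : Prop where
  isCofibrant : IsCofibrant Q
  weakEquivalence : WeakEquivalence q

/-- A monoidal model category: a closed symmetric monoidal category with a model structure
satisfying the pushout product axiom and the unit axiom. -/
class MonoidalModelCategory (C : Type u) [Category.{v} C] [ModelCategory C]
    [MonoidalCategory C] [SymmetricCategory C] [MonoidalClosed C] : Prop where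
  cofibration_pushoutProduct {A B K L : C} (f : A ⟶ B) (g : K ⟶ L)
    (hf : Cofibration f) (hg : Cofibration g) :
    Cofibration ((Arrow.pushoutProduct.obj (.mk f)).obj (.mk g)).hom
  weakEquivalence_pushoutProduct {A B K L : C} (f : A ⟶ B) (g : K ⟶ L)
    (hf : Cofibration f) (hg : Cofibration g) (h : WeakEquivalence f ∨ WeakEquivalence g) :
    WeakEquivalence ((Arrow.pushoutProduct.obj (.mk f)).obj (.mk g)).hom
  unit {Q : C} (q : Q ⟶ 𝟙_ C) (hq : IsCofibrantReplacement q) (A : C) [IsCofibrant A] :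
    WeakEquivalence (q ▷ A)

section Pairs

variable {C : Type u₁} [Category.{v₁} C] {D : Type u₂} [Category.{v₂} D]
variable {L : D ⥤ C} {R : C ⥤ D}

/-- An adjunction between model categories is a Quillen pair if the right adjoint preserves
fibrations and trivial fibrations. -/
structure IsQuillenPair [ModelCategory C] [ModelCategory D] (adj : L ⊣ R) : Prop where
  fibration {X Y : C} (f : X ⟶ Y) (hf : Fibration f) : Fibration (R.map f)
  weakEquivalence {X Y : C} (f : X ⟶ Y) (hf : Fibration f) (hf' : WeakEquivalence f) :
    WeakEquivalence (R.map f)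

variable [MonoidalCategory C] [MonoidalCategory D]

/-- The comonoidal map `L (A ⊗ B) ⟶ L A ⊗ L B`, adjoint to
`A ⊗ B ⟶ R (L A) ⊗ R (L B) ⟶ R (L A ⊗ L B)`. -/
def comonoidalMap (adj : L ⊣ R) [R.LaxMonoidal] (A B : D) :
    L.obj (A ⊗ B) ⟶ L.obj A ⊗ L.obj B :=
  (adj.homEquiv _ _).symm
    ((adj.unit.app A ⊗ₘ adj.unit.app B) ≫ Functor.LaxMonoidal.μ R (L.obj A) (L.obj B))

/-- The map `L 𝟙 ⟶ 𝟙` adjoint to the unit map `𝟙 ⟶ R 𝟙` of the lax monoidal functor `R`. -/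
def counitMap (adj : L ⊣ R) [R.LaxMonoidal] : L.obj (𝟙_ D) ⟶ 𝟙_ C :=
  (adj.homEquiv _ _).symm (Functor.LaxMonoidal.ε R)

/-- A weak monoidal Quillen pair. The condition on the unit is independent of the cofibrant
replacement, and it is required here in its strong form, for all cofibrant replacements. -/
structure IsWeakMonoidalQuillenPair [ModelCategory C] [ModelCategory D]
    (adj : L ⊣ R) [R.LaxMonoidal] : Prop extends IsQuillenPair adj where
  comonoidal (A B : D) [IsCofibrant A] [IsCofibrant B] :
    WeakEquivalence (comonoidalMap adj A B)
  unit {Q : D} (q : Q ⟶ 𝟙_ D) (hq : IsCofibrantReplacement q) :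
    WeakEquivalence (L.map q ≫ counitMap adj)

end Pairs

end MonoidalQuillen

/-! Fix a cofibrant `B`. In the variable `A`, both `F A = L (B ⊗ A)` and `N A = L B ⊗ L A` are left
Quillen functors, and the comonoidal map is a natural transformation `θ : F ⟶ N`. When `A` is a
cofibrant replacement of the unit, the unit axiom and the unit hypothesis show that `θ` is a weak
equivalence at `A`. In particular this holds at every level `Q^n` of a resolution `Q` of the unit.
Transposition identifies maps out of `F Q^n` and `N Q^n` with maps from `Q^n` into the right
adjoints. So the conjugate of `θ` between the right adjoints should become an equivalence after
`map(Q, -)`, hence be a weak equivalence on fibrant objects by detection. Going back through the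
adjunctions, `θ` is then a weak equivalence at every cofibrant `A`.

Lifting properties make this precise once `θ` is replaced by a relative cofibration. With `H A = L
(P.I ⊗ A)` for a good cylinder `P` of `B`, the mapping cylinder `M` of `θ` gives `τ : F ⟶ M` whose
corner maps `F B' ⨿_{F A} M A ⟶ M B'` are cofibrations whenever `A ⟶ B'` is one, while `M ⟶ N` is a
weak equivalence on cofibrant objects. As a pushout of left adjoints, `M` has a right adjoint `E`,
and the conjugate `E ⟶ G` has gap maps that are fibrations on fibrations.

Two arguments by transposition finish the proof. If `τ` is a weak equivalence at each `Q^n`,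
induction over latching objects shows that `map(Q, E X) ⟶ map(Q, G X)` is a trivial Kan fibration
(`isWeakEquivalence_mappingSpaceMap`). If `E X ⟶ G X` is a weak equivalence for all fibrant `X`,
then `τ` at a cofibrant object lifts against fibrations between fibrant objects, which forces it to
be a weak equivalence (`weakEquivalence_app`, `weakEquivalence_of_llp_fibrant`). -/

namespace MonoidalQuillen

/-! ### Trivial Kan fibrations and skeletal lifting for simplicial sets. -/

section SimplicialSets

open Opposite

/-- Postcomposition of a simplicial homotopy. -/
theorem homotopy_postcomp {X Y K : SSet.{v}} {f g : X ⟶ Y} (H : SSet.Homotopy f g) (k : Y ⟶ K) :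
    Nonempty (SSet.Homotopy (f ≫ k) (g ≫ k)) := by
  refine ⟨{ h := H.h ≫ k, h₀ := ?_, h₁ := ?_, rel := ?_ }⟩
  · rw [← Category.assoc, H.h₀]; rfl
  · rw [← Category.assoc, H.h₁]; rfl
  · ext n ⟨⟨x, hx⟩, y⟩
    exact hx.elim

/-- The two ends of the cylinder are disjoint, being told apart by their component in `Δ[1]`. Hence
a homotopy with prescribed ends can be found by lifting against a trivial fibration. -/
instance mono_coprod_desc_ι (X : SSet.{v}) :
    Mono (coprod.desc SSet.ι₀ SSet.ι₁ : X ⨿ X ⟶ X ⊗ Δ[1]) := by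
  rw [NatTrans.mono_iff_mono_app]
  intro n
  rw [mono_iff_injective]
  have hc := isColimitOfPreserves ((CategoryTheory.evaluation _ _).obj n)
    (coprodIsCoprod X X)
  have key : ∀ z : (X ⨿ X).obj n, (∃ x, (coprod.inl : X ⟶ X ⨿ X).app n x = z) ∨
      (∃ x, (coprod.inr : X ⟶ X ⨿ X).app n x = z) := by
    intro z
    obtain ⟨⟨j⟩, x, hx⟩ := Types.jointly_surjective_of_isColimit hc z
    cases j
    · exact Or.inl ⟨x, hx⟩
    · exact Or.inr ⟨x, hx⟩
  have hl : ∀ x : X.obj n, (coprod.desc SSet.ι₀ SSet.ι₁ : X ⨿ X ⟶ X ⊗ Δ[1]).app n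
      ((coprod.inl : X ⟶ X ⨿ X).app n x) = (SSet.ι₀ : X ⟶ X ⊗ Δ[1]).app n x := fun x =>
    ConcreteCategory.congr_hom (congr_app (coprod.inl_desc SSet.ι₀ SSet.ι₁) n) x
  have hr : ∀ x : X.obj n, (coprod.desc SSet.ι₀ SSet.ι₁ : X ⨿ X ⟶ X ⊗ Δ[1]).app n
      ((coprod.inr : X ⟶ X ⨿ X).app n x) = (SSet.ι₁ : X ⟶ X ⊗ Δ[1]).app n x := fun x =>
    ConcreteCategory.congr_hom (congr_app (coprod.inr_desc SSet.ι₀ SSet.ι₁) n) x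
  have hne : ∀ x y : X.obj n, (SSet.ι₀ : X ⟶ X ⊗ Δ[1]).app n x ≠
      (SSet.ι₁ : X ⟶ X ⊗ Δ[1]).app n y := by
    intro x y h
    have h2 := congrArg Prod.snd h
    have h3 : (0 : Fin 2) = 1 :=
      congrArg (fun s => (SSet.stdSimplex.objEquiv s).toOrderHom 0) h2
    exact absurd h3 (by decide)
  intro a b hab
  obtain ⟨x, rfl⟩ | ⟨x, rfl⟩ := key a <;> obtain ⟨y, rfl⟩ | ⟨y, rfl⟩ := key b
  · rw [hl, hl] at hab
    obtain rfl : x = y := congrArg Prod.fst hab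
    rfl
  · rw [hl, hr] at hab
    exact absurd hab (hne _ _)
  · rw [hr, hl] at hab
    exact absurd hab.symm (hne _ _)
  · rw [hr, hr] at hab
    obtain rfl : x = y := congrArg Prod.fst hab
    rfl

/-- A trivial Kan fibration is a weak equivalence. -/
theorem isWeakEquivalence_of_rlp {S T : SSet.{v}} (p : S ⟶ T)
    (hp : SSet.modelCategoryQuillen.I.rlp p) : IsWeakEquivalence p := by
  rw [← SSet.rlp_monomorphisms] at hp
  have lift {A B : SSet.{v}} (i : A ⟶ B) [Mono i] : HasLiftingProperty i p :=
    hp _ (MorphismProperty.monomorphisms.infer_property i)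
  obtain ⟨s, hs⟩ : ∃ s : T ⟶ S, s ≫ p = 𝟙 T := by
    have sq : CommSq (SSet.Subcomplex.isInitialBot.to S) (⊥ : T.Subcomplex).ι p (𝟙 T) :=
      ⟨SSet.Subcomplex.isInitialBot.hom_ext _ _⟩
    have := lift (⊥ : T.Subcomplex).ι
    exact ⟨sq.lift, sq.fac_right⟩
  obtain ⟨H⟩ : Nonempty (SSet.Homotopy (p ≫ s) (𝟙 S)) := by
    have sq : CommSq (coprod.desc (p ≫ s) (𝟙 S))
        (coprod.desc SSet.ι₀ SSet.ι₁ : S ⨿ S ⟶ S ⊗ Δ[1]) p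
        (CartesianMonoidalCategory.fst S Δ[1] ≫ p) := ⟨by
      ext : 1
      · rw [coprod.inl_desc_assoc, coprod.inl_desc_assoc, Category.assoc, hs, Category.comp_id]
        rfl
      · rw [coprod.inr_desc_assoc, coprod.inr_desc_assoc, Category.id_comp]
        rfl⟩
    have := lift (coprod.desc SSet.ι₀ SSet.ι₁ : S ⨿ S ⟶ S ⊗ Δ[1])
    refine ⟨{ h := sq.lift, h₀ := ?_, h₁ := ?_, rel := ?_ }⟩
    · have := coprod.inl ≫= sq.fac_left
      rwa [coprod.inl_desc_assoc, coprod.inl_desc] at this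
    · have := coprod.inr ≫= sq.fac_left
      rwa [coprod.inr_desc_assoc, coprod.inr_desc] at this
    · ext n ⟨⟨x, hx⟩, y⟩
      exact hx.elim
  intro K _
  -- Injectivity needs only the section `s`; surjectivity needs the homotopy from `p ≫ s` to the
  -- identity.
  constructor
  · rintro ⟨g⟩ ⟨h⟩ hgh
    have e := congrArg (HomotopyClasses.precomp s K) hgh
    change Quot.mk _ (s ≫ p ≫ g) = Quot.mk _ (s ≫ p ≫ h) at e
    rwa [← Category.assoc, ← Category.assoc, hs, Category.id_comp, Category.id_comp] at e
  · rintro ⟨g⟩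
    refine ⟨Quot.mk _ (s ≫ g), Quot.sound ?_⟩
    have := homotopy_postcomp H g
    rwa [Category.assoc, Category.id_comp] at this

/-- A map with the right lifting property with respect to the boundary inclusions of dimension
`< n` has the right lifting property with respect to `⊥ ⟶ K` if `K` has dimension `< n`. -/
theorem hasLiftingProperty_bot {S T K : SSet.{v}} (p : S ⟶ T) (n : ℕ) [K.HasDimensionLT n]
    (hp : ∀ m < n, HasLiftingProperty (SSet.boundary.{v} m).ι p) :
    HasLiftingProperty (⊥ : K.Subcomplex).ι p := by
  let i : ((⊥ : K.Subcomplex) : SSet) ⟶ K := (⊥ : K.Subcomplex).ι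
  have h0 : SSet.skeletonOfMono i 0 = ⊥ := by simp [i]
  -- Stage `d` of the filtration contains the simplices of dimension `< d`, so stage `n` is
  -- everything and passing from `d` to `d + 1` attaches cells of dimension exactly `d`.
  have hn : SSet.skeletonOfMono i n = ⊤ := by
    rw [← top_le_iff, SSet.Subcomplex.le_iff_contains_nonDegenerate]
    intro m x _
    have hm : m < n := SSet.dim_lt_of_nonDegenerate _ x n
    simp [SSet.skeletonOfMono_obj_eq_top i hm]
  have step (d : ℕ) (hd : d < n) :
      HasLiftingProperty (SSet.relativeCellComplexOfMono.r i d) p := by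
    -- Maps lifting against `p` are stable under coproducts and pushouts, hence contain each cell
    -- attachment.
    let W : MorphismProperty SSet.{v} :=
      MorphismProperty.llp (MorphismProperty.ofHoms (fun _ : Unit => p))
    have hl : W (SSet.relativeCellComplexOfMono.l i d) := by
      refine MorphismProperty.colimMap (W := W) _ (fun _ => ?_)
      rintro _ _ _ ⟨⟩
      exact hp d hd
    exact (W.of_isPushout (SSet.relativeCellComplexOfMono.isPushout i d) hl) _ ⟨()⟩
  have key (d : ℕ) (hd : d ≤ n) : HasLiftingProperty (SSet.Subcomplex.homOfLE
      (bot_le : ⊥ ≤ SSet.skeletonOfMono i d)) p := by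
    induction d with
    | zero =>
      have : SSet.Subcomplex.homOfLE (bot_le : ⊥ ≤ SSet.skeletonOfMono i 0) =
        (SSet.Subcomplex.eqToIso h0.symm).hom := rfl
      rw [this]
      infer_instance
    | succ d ih =>
      have := step d (by lia)
      have := ih (by lia)
      exact inferInstanceAs (HasLiftingProperty (SSet.Subcomplex.homOfLE
        (bot_le : ⊥ ≤ SSet.skeletonOfMono i d) ≫ SSet.relativeCellComplexOfMono.r i d) p)
  have e : (⊥ : K.Subcomplex).ι = SSet.Subcomplex.homOfLE
      (bot_le : ⊥ ≤ SSet.skeletonOfMono i n) ≫ (SSet.Subcomplex.eqToIso hn).hom ≫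
      (SSet.Subcomplex.topIso K).hom := rfl
  have := key n le_rfl
  rw [e]
  infer_instance

end SimplicialSets

/-! ### Latching objects as boundaries: maps `latchingObj Q n ⟶ Y` are maps `∂Δ[n] ⟶ map(Q, Y)`. -/

section Latching

open Opposite

variable {C : Type u} [Category.{v} C]

theorem not_surjective_of_mono_of_not_isIso {X : SimplexCategory} {n : ℕ} (f : X ⟶ ⦋n⦌) [Mono f]
    (hf : ¬ IsIso f) : ¬ Function.Surjective f.toOrderHom := fun h =>
  hf (by
    have := SimplexCategory.epi_iff_surjective.2 h
    exact isIso_of_mono_of_epi f)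

/-- The object of the latching category given by a monomorphism that is not an isomorphism. -/
def latchingMk {X : SimplexCategory} {n : ℕ} (f : X ⟶ ⦋n⦌) [hf : Mono f] (hf' : ¬ IsIso f) :
    LatchingCategory n :=
  ⟨Over.mk f, hf, hf'⟩

/-- The morphism in the latching category given by a commutative triangle. -/
def latchingHomMk {X Y : SimplexCategory} {n : ℕ} {f : X ⟶ ⦋n⦌} [Mono f] {hf : ¬ IsIso f}
    {g : Y ⟶ ⦋n⦌} [Mono g] {hg : ¬ IsIso g} (k : X ⟶ Y) (hk : k ≫ g = f) :
    latchingMk f hf ⟶ latchingMk g hg :=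
  ObjectProperty.homMk (Over.homMk k hk)

/-- Every non surjective map to `⦋n⦌` factors through an object of the latching category. -/
theorem exists_latching_fac {X : SimplexCategory} {n : ℕ} (f : X ⟶ ⦋n⦌)
    (hf : ¬ Function.Surjective f.toOrderHom) :
    ∃ (j : LatchingCategory n) (a : X ⟶ j.obj.left), a ≫ j.obj.hom = f := by
  refine ⟨latchingMk (image.ι f) (fun _ => hf ?_), factorThruImage f, image.fac f⟩
  have : Epi f := by
    rw [← image.fac f]
    infer_instance
  exact SimplexCategory.epi_iff_surjective.1 this

/-- Two factorizations of the same map through objects of the latching category give the same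
map to the colimit. -/
theorem latching_fac_unique {Q : CosimplicialObject C} {n : ℕ} (c : Cocone (latchingDiagram Q n))
    {X : SimplexCategory} (j j' : LatchingCategory n) (a : X ⟶ j.obj.left)
    (a' : X ⟶ j'.obj.left) (h : a ≫ j.obj.hom = a' ≫ j'.obj.hom) :
    Q.map a ≫ c.ι.app j = Q.map a' ≫ c.ι.app j' := by
  -- Every factorization is compared with the image factorization, which is initial among those with
  -- a monomorphism as second factor. Its inclusion is not invertible, since otherwise `j.obj.hom`
  -- would be an epimorphism, hence an isomorphism.
  have key (i : LatchingCategory n) (b : X ⟶ i.obj.left) (hb : b ≫ i.obj.hom = a ≫ j.obj.hom) :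
      Q.map b ≫ c.ι.app i = Q.map (factorThruImage (a ≫ j.obj.hom)) ≫
        c.ι.app (latchingMk (image.ι (a ≫ j.obj.hom)) (fun hi => j.property.2 (by
          have := j.property.1
          have : Epi j.obj.hom := by
            have : Epi (a ≫ j.obj.hom) := by
              rw [← image.fac (a ≫ j.obj.hom)]
              infer_instance
            exact epi_of_epi a _
          exact isIso_of_mono_of_epi _))) := by
    have := i.property.1
    let F : MonoFactorisation (a ≫ j.obj.hom) := { I := _, m := i.obj.hom, e := b, fac := hb }
    rw [← c.w (latchingHomMk (hg := i.property.2) (image.lift F) (image.lift_fac F))]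
    have e : factorThruImage (a ≫ j.obj.hom) ≫ image.lift F = b := image.fac_lift F
    exact (congrArg (fun t => t ≫ c.ι.app i) ((congrArg Q.map e.symm).trans
      (Q.map_comp _ _))).trans (Category.assoc _ _ _)
  rw [key j a rfl, key j' a' h.symm]

/-- The map from the boundary of the standard simplex to a mapping space that is induced by a map
from the latching object. -/
noncomputable def boundaryToMappingSpace {Q : CosimplicialObject C} {n : ℕ}
    (c : Cocone (latchingDiagram Q n)) : (SSet.boundary.{v} n : SSet.{v}) ⟶ mappingSpace Q c.pt where
  app m := TypeCat.ofHom fun x =>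
    let h := exists_latching_fac (SSet.stdSimplex.objEquiv x.1) x.2
    Q.map h.choose_spec.choose ≫ c.ι.app h.choose
  naturality m m' k := by
    ext x
    have h := exists_latching_fac (SSet.stdSimplex.objEquiv x.1) x.2
    let x' := (SSet.boundary.{v} n : SSet.{v}).map k x
    have h' := exists_latching_fac (SSet.stdSimplex.objEquiv x'.1) x'.2
    change Q.map h'.choose_spec.choose ≫ c.ι.app h'.choose =
      Q.map k.unop ≫ Q.map h.choose_spec.choose ≫ c.ι.app h.choose
    refine (latching_fac_unique c h'.choose h.choose h'.choose_spec.choose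
      (k.unop ≫ h.choose_spec.choose) ?_).trans
      ((congrArg (fun t => t ≫ c.ι.app h.choose) (Q.map_comp _ _)).trans (Category.assoc _ _ _))
    rw [h'.choose_spec.choose_spec, Category.assoc, h.choose_spec.choose_spec]
    rfl

theorem boundaryToMappingSpace_app {Q : CosimplicialObject C} {n : ℕ}
    (c : Cocone (latchingDiagram Q n)) {m : SimplexCategoryᵒᵖ}
    (x : (SSet.boundary.{v} n : SSet.{v}).obj m) (j : LatchingCategory n)
    (a : m.unop ⟶ j.obj.left) (h : a ≫ j.obj.hom = SSet.stdSimplex.objEquiv x.1) :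
    (boundaryToMappingSpace c).app m x = Q.map a ≫ c.ι.app j := by
  have h' := exists_latching_fac (SSet.stdSimplex.objEquiv x.1) x.2
  exact latching_fac_unique c _ _ _ _ (h'.choose_spec.choose_spec.trans h.symm)

/-- The simplex of the boundary given by an object of the latching category. -/
def latchingSimplex {n : ℕ} (j : LatchingCategory n) :
    (SSet.boundary.{v} n : SSet.{v}).obj (op j.obj.left) :=
  ⟨SSet.stdSimplex.objEquiv.symm j.obj.hom, by
    have := j.property.1
    exact not_surjective_of_mono_of_not_isIso j.obj.hom j.property.2⟩

/-- The cocone over the latching diagram given by a map from the boundary of the standard simplex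
to a mapping space. -/
def coconeOfBoundary {Q : CosimplicialObject C} {n : ℕ} {Y : C}
    (w : (SSet.boundary.{v} n : SSet.{v}) ⟶ mappingSpace Q Y) : Cocone (latchingDiagram Q n) where
  pt := Y
  ι :=
    { app j := w.app _ (latchingSimplex j)
      naturality j j' k := by
        have h := ConcreteCategory.congr_hom (w.naturality k.hom.left.op) (latchingSimplex j')
        have e : (SSet.boundary.{v} n : SSet.{v}).map k.hom.left.op (latchingSimplex j') =
            latchingSimplex j := by
          apply Subtype.ext
          apply SSet.stdSimplex.objEquiv.injective
          exact Over.w k.hom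
        refine Eq.trans ?_ (Category.comp_id _).symm
        refine h.symm.trans ?_
        exact congrArg (w.app _) e }

theorem app_eq_of_fac {Q : CosimplicialObject C} {n : ℕ} {Y : C}
    (w : (SSet.boundary.{v} n : SSet.{v}) ⟶ mappingSpace Q Y) {m : SimplexCategoryᵒᵖ}
    (x : (SSet.boundary.{v} n : SSet.{v}).obj m) (j : LatchingCategory n)
    (a : m.unop ⟶ j.obj.left) (h : a ≫ j.obj.hom = SSet.stdSimplex.objEquiv x.1) :
    w.app m x = Q.map a ≫ (coconeOfBoundary w).ι.app j := by
  have e : (SSet.boundary.{v} n : SSet.{v}).map a.op (latchingSimplex j) = x := by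
    apply Subtype.ext
    apply SSet.stdSimplex.objEquiv.injective
    exact h
  rw [← e]
  exact ConcreteCategory.congr_hom (w.naturality a.op) (latchingSimplex j)

theorem mappingSpace_app_eq (Q : CosimplicialObject C) {n : ℕ} {Z : C}
    (z : SSet.stdSimplex.{v}.obj ⦋n⦌ ⟶ mappingSpace Q Z) {m : SimplexCategoryᵒᵖ}
    (x : (SSet.stdSimplex.{v}.obj ⦋n⦌).obj m) :
    z.app m x = Q.map (SSet.stdSimplex.objEquiv x) ≫ (SSet.yonedaEquiv z : Q.obj ⦋n⦌ ⟶ Z) := by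
  obtain ⟨l, rfl⟩ := SSet.yonedaEquiv.symm.surjective z
  rw [Equiv.apply_symm_apply]
  rfl

variable [HasFiniteColimits C]

/-- The inclusion of a summand of the latching object. -/
noncomputable def latchingι (Q : CosimplicialObject C) {n : ℕ} (j : LatchingCategory n) :
    Q.obj j.obj.left ⟶ latchingObj Q n :=
  colimit.ι (latchingDiagram Q n) j

theorem latchingι_latchingMap (Q : CosimplicialObject C) {n : ℕ} (j : LatchingCategory n) :
    latchingι Q j ≫ latchingMap Q n = Q.map j.obj.hom :=
  colimit.ι_desc _ _

theorem latchingObj_hom_ext {Q : CosimplicialObject C} {n : ℕ} {Y : C} {f g : latchingObj Q n ⟶ Y}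
    (h : ∀ j, latchingι Q j ≫ f = latchingι Q j ≫ g) : f = g :=
  colimit.hom_ext h

/-- The map from the latching object given by a map from the boundary of the standard simplex
to a mapping space. -/
noncomputable def latchingDesc {Q : CosimplicialObject C} {n : ℕ} {Y : C}
    (w : (SSet.boundary.{v} n : SSet.{v}) ⟶ mappingSpace Q Y) : latchingObj Q n ⟶ Y :=
  colimit.desc _ (coconeOfBoundary w)

theorem latchingι_latchingDesc {Q : CosimplicialObject C} {n : ℕ} {Y : C}
    (w : (SSet.boundary.{v} n : SSet.{v}) ⟶ mappingSpace Q Y) (j : LatchingCategory n) :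
    latchingι Q j ≫ latchingDesc w = w.app _ (latchingSimplex j) :=
  colimit.ι_desc _ _

theorem app_eq_comp_latchingDesc {Q : CosimplicialObject C} {n : ℕ} {Y : C}
    (w : (SSet.boundary.{v} n : SSet.{v}) ⟶ mappingSpace Q Y) {m : SimplexCategoryᵒᵖ}
    (x : (SSet.boundary.{v} n : SSet.{v}).obj m) (j : LatchingCategory n)
    (a : m.unop ⟶ j.obj.left) (h : a ≫ j.obj.hom = SSet.stdSimplex.objEquiv x.1) :
    w.app m x = Q.map a ≫ latchingι Q j ≫ latchingDesc w := by
  rw [latchingι_latchingDesc]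
  exact app_eq_of_fac w x j a h

/-- A square from `∂Δ[n] ⟶ Δ[n]` to `map(Q, g)` is the same as a square from the latching map to
`g`: the Yoneda lemma handles `Δ[n]`, and the universal property of the latching colimit handles the
boundary. -/
theorem hasLiftingProperty_mappingSpaceMap (Q : CosimplicialObject C) (n : ℕ) {Y Z : C}
    (g : Y ⟶ Z) [HasLiftingProperty (latchingMap Q n) g] :
    HasLiftingProperty (SSet.boundary.{v} n).ι (mappingSpaceMap Q g) where
  sq_hasLift {w z} sq := by
    let z' : Q.obj ⦋n⦌ ⟶ Z := SSet.yonedaEquiv z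
    have sq' : CommSq (latchingDesc w) (latchingMap Q n) g z' := ⟨by
      refine latchingObj_hom_ext fun j => ?_
      rw [← Category.assoc, ← Category.assoc, latchingι_latchingDesc, latchingι_latchingMap]
      refine Eq.trans (ConcreteCategory.congr_hom (congr_app sq.w _) (latchingSimplex j)) ?_
      exact mappingSpace_app_eq Q z _⟩
    let l : Q.obj ⦋n⦌ ⟶ Y := sq'.lift
    refine ⟨⟨⟨SSet.yonedaEquiv.symm l, ?_, ?_⟩⟩⟩
    · ext m x
      obtain ⟨j, a, h⟩ := exists_latching_fac (SSet.stdSimplex.objEquiv x.1) x.2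
      refine Eq.trans ?_ (app_eq_comp_latchingDesc w x j a h).symm
      rw [← sq'.fac_left, ← Category.assoc (latchingι Q j), latchingι_latchingMap,
        ← Category.assoc, ← Q.map_comp, h]
      rfl
    · ext m x
      refine Eq.trans ?_ (mappingSpace_app_eq Q z x).symm
      change (Q.map (SSet.stdSimplex.objEquiv x) ≫ l) ≫ g = _
      rw [Category.assoc, sq'.fac_right]

/-- The problem translates into lifting `∅ ⟶ ∂Δ[n]` against `map(Q, g)`, and `∂Δ[n]` is built from
cells of dimension `< n`. This gives access to the latching object through latching maps of lower
degree only. -/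
theorem hasLiftingProperty_initial_latchingObj (Q : CosimplicialObject C) (n : ℕ) {Y Z : C}
    (g : Y ⟶ Z) (h : ∀ m < n, HasLiftingProperty (latchingMap Q m) g) :
    HasLiftingProperty (initial.to (latchingObj Q n)) g where
  sq_hasLift {i z} sq := by
    have := hasLiftingProperty_bot (K := (SSet.boundary.{v} n : SSet.{v})) (mappingSpaceMap Q g) n
      (fun m hm => by
        have := h m hm
        exact hasLiftingProperty_mappingSpaceMap Q m g)
    let c := (colimit.cocone (latchingDiagram Q n)).extend z
    have sq' : CommSq (SSet.Subcomplex.isInitialBot.to _)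
        (⊥ : (SSet.boundary.{v} n : SSet.{v}).Subcomplex).ι
        (mappingSpaceMap Q g) (boundaryToMappingSpace c) :=
      ⟨SSet.Subcomplex.isInitialBot.hom_ext _ _⟩
    refine ⟨⟨⟨latchingDesc sq'.lift, initialIsInitial.hom_ext _ _, ?_⟩⟩⟩
    refine latchingObj_hom_ext fun j => ?_
    rw [← Category.assoc, latchingι_latchingDesc]
    refine Eq.trans (ConcreteCategory.congr_hom (congr_app sq'.fac_right _)
      (latchingSimplex j)) ?_
    refine (boundaryToMappingSpace_app c (latchingSimplex j) j (𝟙 _) (Category.id_comp _)).trans ?_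
    exact (congrArg (fun t => t ≫ c.ι.app j) (Q.map_id _)).trans (Category.id_comp _)

theorem isCofibrant_obj_of_isReedyCofibrant {C : Type u} [Category.{v} C] [ModelCategory C]
    {Q : CosimplicialObject C} (hQ : IsReedyCofibrant Q) (n : ℕ) : IsCofibrant (Q.obj ⦋n⦌) := by
  have (m : ℕ) := hQ m
  rw [isCofibrant_iff, cofibration_iff, ← trivialFibrations_llp]
  intro Y Z g hg
  obtain ⟨_, _⟩ := (mem_trivialFibrations_iff g).1 hg
  have := hasLiftingProperty_initial_latchingObj Q n g (fun m _ => inferInstance)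
  have e : initial.to (Q.obj ⦋n⦌) = initial.to (latchingObj Q n) ≫ latchingMap Q n :=
    initialIsInitial.hom_ext _ _
  rw [e]
  infer_instance

end Latching

/-! ### Lifting criteria in model categories and left Quillen functors. -/

section Lifting

variable {C : Type u} [Category.{v} C] [ModelCategory C]

theorem cofibration_of_llp {X Y : C} (i : X ⟶ Y)
    (h : ∀ ⦃A B : C⦄ (f : A ⟶ B) [Fibration f] [WeakEquivalence f], HasLiftingProperty i f) :
    Cofibration i := by
  rw [cofibration_iff, ← trivialFibrations_llp]
  intro A B f hf
  obtain ⟨_, _⟩ := (mem_trivialFibrations_iff f).1 hf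
  exact h f

theorem trivialCofibration_of_llp {X Y : C} (i : X ⟶ Y)
    (h : ∀ ⦃A B : C⦄ (f : A ⟶ B) [Fibration f], HasLiftingProperty i f) :
    Cofibration i ∧ WeakEquivalence i := by
  rw [← mem_trivialCofibrations_iff, ← fibrations_llp]
  intro A B f hf
  have := (fibration_iff f).2 hf
  exact h f

theorem fibration_of_rlp {X Y : C} (f : X ⟶ Y)
    (h : ∀ ⦃A B : C⦄ (i : A ⟶ B) [Cofibration i] [WeakEquivalence i], HasLiftingProperty i f) :
    Fibration f := by
  rw [fibration_iff, ← trivialCofibrations_rlp]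
  intro A B i hi
  obtain ⟨_, _⟩ := (mem_trivialCofibrations_iff i).1 hi
  exact h i

/-- A cofibration between cofibrant objects which has the left lifting property with respect to
the fibrations between fibrant objects is a weak equivalence. -/
theorem weakEquivalence_of_llp_fibrant {U V : C} [IsCofibrant U] (j : U ⟶ V)
    [Cofibration j]
    (h : ∀ ⦃X Y : C⦄ [IsFibrant X] [IsFibrant Y] (f : X ⟶ Y) [Fibration f],
      HasLiftingProperty j f) : WeakEquivalence j := by
  have : IsCofibrant V := isCofibrant_of_cofibration j
  obtain ⟨V', v, _, _, _⟩ : ∃ (V' : C) (v : V ⟶ V'), Cofibration v ∧ WeakEquivalence v ∧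
      IsFibrant V' :=
    ⟨_, FibrantObject.HoCat.iResolutionObj V, inferInstance, inferInstance, inferInstance⟩
  have : IsCofibrant V' := isCofibrant_of_cofibration v
  -- It suffices that the fibration `d.p` is a weak equivalence. It lies between fibrant objects, so
  -- `j` lifts against it; the lift extends along `v` to a section `l` of `d.p` up to homotopy.
  let d := MorphismProperty.factorizationData (trivialCofibrations C) (fibrations C) (j ≫ v)
  have : IsFibrant d.Z := isFibrant_of_fibration d.p
  have : IsCofibrant d.Z := isCofibrant_of_cofibration d.i
  have := h d.p
  have sq : CommSq d.i j d.p v := ⟨d.fac⟩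
  have sq' : CommSq sq.lift v (terminal.from d.Z) (terminal.from V') := ⟨terminalIsTerminal.hom_ext _ _⟩
  let l : V' ⟶ d.Z := sq'.lift
  have hl : v ≫ l = sq.lift := sq'.fac_left
  have hlp : LeftHomotopyRel (l ≫ d.p) (𝟙 V') := by
    rw [leftHomotopyRel_iff_rightHomotopyRel, ← RightHomotopyClass.mk_eq_mk_iff]
    apply (RightHomotopyClass.precomp_bijective_of_weakEquivalence V' v).1
    simp only [RightHomotopyClass.precomp_mk]
    rw [← Category.assoc, hl, sq.fac_right, Category.comp_id]
  obtain ⟨P, _, ⟨H⟩⟩ := hlp.exists_good_cylinder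
  -- Moving `l` along a lift of the homotopy turns it into a strict section `s`.
  obtain ⟨s, H', hs⟩ := Cylinder.LeftHomotopy.covering_homotopy H d.p l
  have hs1 : s ≫ d.p = 𝟙 V' := by
    rw [← H'.h₁, Category.assoc, hs, H.h₁]
  -- Both maps agree up to homotopy after the trivial cofibration `d.i`. Thus `d.p ≫ s` is a weak
  -- equivalence, and `d.p` is a retract of it because `s` is a section.
  have hps : LeftHomotopyRel (d.p ≫ s) (𝟙 d.Z) := by
    rw [leftHomotopyRel_iff_rightHomotopyRel, ← RightHomotopyClass.mk_eq_mk_iff]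
    apply (RightHomotopyClass.precomp_bijective_of_weakEquivalence d.Z d.i).1
    simp only [RightHomotopyClass.precomp_mk]
    rw [RightHomotopyClass.mk_eq_mk_iff, ← leftHomotopyRel_iff_rightHomotopyRel,
      ← Category.assoc, d.fac, Category.assoc, Category.comp_id]
    have h2 : LeftHomotopyRel (l) s := H'.leftHomotopyRel
    have h3 : LeftHomotopyRel ((j ≫ v) ≫ l) ((j ≫ v) ≫ s) := h2.precomp _
    rw [Category.assoc, Category.assoc, hl, sq.fac_left] at h3
    exact h3.symm
  obtain ⟨P', ⟨H''⟩⟩ := hps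
  have hw : WeakEquivalence (d.p ≫ s) := H''.weakEquivalence_iff.2 inferInstance
  have : WeakEquivalence d.p := by
    rw [weakEquivalence_iff] at hw ⊢
    exact MorphismProperty.of_retract (f := d.p) (g := d.p ≫ s)
      { i := Arrow.homMk (𝟙 _) s (by simp)
        r := Arrow.homMk (𝟙 _) d.p (by simp [hs1])
        retract := by ext <;> simp [hs1] } hw
  have : WeakEquivalence (j ≫ v) := by
    rw [← d.fac]
    infer_instance
  exact weakEquivalence_of_postcomp j v

/-- A functor between model categories is a left Quillen functor if the images of cofibrations
lift against fibrations whenever one of the two is a weak equivalence. -/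
structure IsLeftQuillen {D : Type u₂} [Category.{v₂} D] [ModelCategory D] (F : D ⥤ C) : Prop where
  lift {A B : D} (i : A ⟶ B) {X Y : C} (f : X ⟶ Y) [Cofibration i] [Fibration f]
    (h : WeakEquivalence i ∨ WeakEquivalence f) : HasLiftingProperty (F.map i) f

namespace IsLeftQuillen

variable {D : Type u₂} [Category.{v₂} D] [ModelCategory D] {F : D ⥤ C} {G : C ⥤ D}
  (hF : IsLeftQuillen F) (adj : F ⊣ G)
include hF

theorem cofibration {A B : D} (i : A ⟶ B) [Cofibration i] : Cofibration (F.map i) :=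
  cofibration_of_llp _ fun _ _ f _ h => hF.lift i f (Or.inr h)

theorem weakEquivalence_of_cofibration {A B : D} (i : A ⟶ B) [Cofibration i]
    [h : WeakEquivalence i] : WeakEquivalence (F.map i) :=
  (trivialCofibration_of_llp _ fun _ _ f _ => hF.lift i f (Or.inl h)).2

/-- Left Quillen functors preserve weak equivalences between cofibrant objects. -/
theorem weakEquivalence {A B : D} (f : A ⟶ B) [IsCofibrant A] [IsCofibrant B]
    [WeakEquivalence f] : WeakEquivalence (F.map f) := by
  let h : CofibrantBrownFactorization f := Classical.arbitrary _
  have := hF.weakEquivalence_of_cofibration h.i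
  have := hF.weakEquivalence_of_cofibration h.s
  have : WeakEquivalence (F.map h.p) :=
    weakEquivalence_of_precomp_of_fac (f := F.map h.s) (fg := 𝟙 _)
      (by rw [← F.map_comp, h.s_p, F.map_id])
  rw [← h.fac, F.map_comp]
  infer_instance

include adj

theorem isCofibrant (A : D) [IsCofibrant A] : IsCofibrant (F.obj A) := by
  have := adj.leftAdjoint_preservesColimits
  rw [isCofibrant_iff_of_isInitial (F.map (initial.to A)) (initialIsInitial.isInitialObj F _)]
  exact hF.cofibration (initial.to A)

theorem fibration {X Y : C} (f : X ⟶ Y) [Fibration f] : Fibration (G.map f) :=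
  fibration_of_rlp _ fun _ _ i _ h => by
    rw [← adj.hasLiftingProperty_iff]
    exact hF.lift i f (Or.inl h)

theorem isFibrant (X : C) [IsFibrant X] : IsFibrant (G.obj X) := by
  have := adj.rightAdjoint_preservesLimits
  rw [isFibrant_iff_of_isTerminal (G.map (terminal.from X)) (terminalIsTerminal.isTerminalObj G _)]
  exact hF.fibration adj (terminal.from X)

end IsLeftQuillen

end Lifting

/-! ### Corner maps of a transformation of left adjoints and gap maps of its conjugate. -/

section Corner

variable {C : Type u₁} [Category.{v₁} C] {D : Type u₂} [Category.{v₂} D]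
variable {F M : D ⥤ C} {G E : C ⥤ D} (adjF : F ⊣ G) (adjM : M ⊣ E) (τ : F ⟶ M) (p : E ⟶ G)

/-- The transposes of composition with a natural transformation between left adjoints are
given by composition with the conjugate transformation. -/
theorem homEquiv_app_comp {A : D} {X : C} (u : M.obj A ⟶ X) :
    adjF.homEquiv A X (τ.app A ≫ u) =
      adjM.homEquiv A X u ≫ (conjugateEquiv adjM adjF τ).app X := by
  rw [Adjunction.homEquiv_unit, Adjunction.homEquiv_unit, G.map_comp, ← Category.assoc,
    ← unit_conjugateEquiv adjM adjF τ A, Category.assoc, Category.assoc, NatTrans.naturality]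

/-- The map `F B ⨿_{F A} M A ⟶ M B` induced by `τ : F ⟶ M` and `i : A ⟶ B`. -/
noncomputable def corner [HasPushouts C] {A B : D} (i : A ⟶ B) :
    pushout (F.map i) (τ.app A) ⟶ M.obj B :=
  pushout.desc (τ.app B) (M.map i) (τ.naturality i)

/-- The map `E X ⟶ E Y ×_{G Y} G X` induced by `p : E ⟶ G` and `f : X ⟶ Y`. -/
noncomputable def gap [HasPullbacks D] {X Y : C} (f : X ⟶ Y) :
    E.obj X ⟶ pullback (p.app Y) (G.map f) :=
  pullback.lift (E.map f) (p.app X) (p.naturality f)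

@[simp]
theorem inl_corner [HasPushouts C] {A B : D} (i : A ⟶ B) :
    pushout.inl _ _ ≫ corner τ i = τ.app B :=
  pushout.inl_desc _ _ _

@[simp]
theorem inr_corner [HasPushouts C] {A B : D} (i : A ⟶ B) :
    pushout.inr _ _ ≫ corner τ i = M.map i :=
  pushout.inr_desc _ _ _

@[simp]
theorem gap_fst [HasPullbacks D] {X Y : C} (f : X ⟶ Y) :
    gap p f ≫ pullback.fst _ _ = E.map f :=
  pullback.lift_fst _ _ _

@[simp]
theorem gap_snd [HasPullbacks D] {X Y : C} (f : X ⟶ Y) :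
    gap p f ≫ pullback.snd _ _ = p.app X :=
  pullback.lift_snd _ _ _

/-- Transposing each component across the two adjunctions turns a square from `i` to the gap map
into a square from the corner map to `f`. -/
theorem hasLiftingProperty_gap [HasPushouts C] [HasPullbacks D] {A B : D} (i : A ⟶ B)
    {X Y : C} (f : X ⟶ Y) [HasLiftingProperty (corner τ i) f] :
    HasLiftingProperty i (gap (conjugateEquiv adjM adjF τ) f) where
  sq_hasLift {a b} sq := by
    obtain ⟨a, rfl⟩ := (adjM.homEquiv _ _).surjective a
    obtain ⟨b₁, hb₁⟩ := (adjF.homEquiv _ _).surjective (b ≫ pullback.snd _ _)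
    obtain ⟨b₂, hb₂⟩ := (adjM.homEquiv _ _).surjective (b ≫ pullback.fst _ _)
    have e₁ := sq.w =≫ pullback.fst _ _
    have e₂ := sq.w =≫ pullback.snd _ _
    rw [Category.assoc, Category.assoc, gap_fst, ← hb₂] at e₁
    rw [Category.assoc, Category.assoc, gap_snd, ← hb₁] at e₂
    have e₁' : a ≫ f = M.map i ≫ b₂ := by
      apply (adjM.homEquiv _ _).injective
      rw [Adjunction.homEquiv_naturality_left, Adjunction.homEquiv_naturality_right, e₁]
    have e₂' : F.map i ≫ b₁ = τ.app A ≫ a := by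
      apply (adjF.homEquiv _ _).injective
      rw [Adjunction.homEquiv_naturality_left, homEquiv_app_comp adjF adjM, e₂]
    have e₃ : τ.app B ≫ b₂ = b₁ ≫ f := by
      apply (adjF.homEquiv _ _).injective
      rw [homEquiv_app_comp adjF adjM, Adjunction.homEquiv_naturality_right, hb₁, hb₂,
        Category.assoc, Category.assoc, pullback.condition]
    have sq' : CommSq (pushout.desc b₁ a e₂') (corner τ i) f b₂ := ⟨by
      apply pushout.hom_ext
      · rw [pushout.inl_desc_assoc, ← Category.assoc, inl_corner, e₃]
      · rw [pushout.inr_desc_assoc, ← Category.assoc, inr_corner, e₁']⟩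
    obtain ⟨l, hl, hl'⟩ : ∃ l, corner τ i ≫ l = pushout.desc b₁ a e₂' ∧ l ≫ f = b₂ :=
      ⟨sq'.lift, sq'.fac_left, sq'.fac_right⟩
    have f₁ : τ.app B ≫ l = b₁ := by rw [← inl_corner τ i, Category.assoc, hl, pushout.inl_desc]
    have f₂ : M.map i ≫ l = a := by rw [← inr_corner τ i, Category.assoc, hl, pushout.inr_desc]
    refine ⟨⟨⟨adjM.homEquiv _ _ l, ?_, ?_⟩⟩⟩
    · rw [← Adjunction.homEquiv_naturality_left, f₂]
    · apply pullback.hom_ext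
      · rw [Category.assoc, gap_fst, ← Adjunction.homEquiv_naturality_right, hl', hb₂]
      · rw [Category.assoc, gap_snd, ← homEquiv_app_comp adjF adjM, f₁, hb₁]

/-- A square from `τ.app A` to `f` transposes to a map from `A` to the target of the gap map, and a
diagonal to a lift of that map along the gap map. -/
theorem hasLiftingProperty_app_of_initial [HasInitial D] [HasPullbacks D] {A : D} {X Y : C}
    (f : X ⟶ Y) [HasLiftingProperty (initial.to A) (gap (conjugateEquiv adjM adjF τ) f)] :
    HasLiftingProperty (τ.app A) f where
  sq_hasLift {a b} sq := by
    have sq' : CommSq (initial.to _) (initial.to A) (gap (conjugateEquiv adjM adjF τ) f)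
        (pullback.lift (adjM.homEquiv _ _ b) (adjF.homEquiv _ _ a) (by
          rw [← homEquiv_app_comp adjF adjM, ← Adjunction.homEquiv_naturality_right, sq.w])) :=
      ⟨initialIsInitial.hom_ext _ _⟩
    obtain ⟨l, hl⟩ := (adjM.homEquiv _ _).surjective sq'.lift
    have e := sq'.fac_right
    rw [← hl] at e
    have e₁ := e =≫ pullback.fst _ _
    have e₂ := e =≫ pullback.snd _ _
    rw [Category.assoc, gap_fst, pullback.lift_fst] at e₁
    rw [Category.assoc, gap_snd, pullback.lift_snd] at e₂
    refine ⟨⟨⟨l, ?_, ?_⟩⟩⟩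
    · apply (adjF.homEquiv _ _).injective
      rw [homEquiv_app_comp adjF adjM, e₂]
    · apply (adjM.homEquiv _ _).injective
      rw [Adjunction.homEquiv_naturality_right, e₁]

variable [ModelCategory C] [ModelCategory D]

/-- A natural transformation `τ : F ⟶ M` such that `F` is a left Quillen functor and the corner
maps of `τ` lift against fibrations in the same way as the images of cofibrations by `F`. -/
structure IsLeftQuillenTrans : Prop where
  left : IsLeftQuillen F
  corner {A B : D} (i : A ⟶ B) {X Y : C} (f : X ⟶ Y) [Cofibration i] [Fibration f]
    (h : WeakEquivalence i ∨ WeakEquivalence f) : HasLiftingProperty (corner τ i) f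

variable {τ}

namespace IsLeftQuillenTrans

variable (hτ : IsLeftQuillenTrans τ)
include hτ

/-- `M.map i` is a pushout of `F.map i` followed by the corner map. -/
theorem right : IsLeftQuillen M where
  lift {A B} i X Y f _ _ h := by
    have := hτ.corner i f h
    have := hτ.left.lift i f h
    rw [← inr_corner τ i]
    infer_instance

theorem cofibration_corner {A B : D} (i : A ⟶ B) [Cofibration i] :
    Cofibration (MonoidalQuillen.corner τ i) :=
  cofibration_of_llp _ fun _ _ f _ h => hτ.corner i f (Or.inr h)

include adjF adjM

theorem cofibration_app (A : D) [IsCofibrant A] : Cofibration (τ.app A) :=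
  cofibration_of_llp _ fun _ _ f _ h => by
    have := hτ.corner (initial.to A) f (Or.inr h)
    have := hasLiftingProperty_gap adjF adjM τ (initial.to A) f
    exact hasLiftingProperty_app_of_initial adjF adjM τ f

theorem fibration_gap {X Y : C} (f : X ⟶ Y) [Fibration f] :
    Fibration (gap (conjugateEquiv adjM adjF τ) f) :=
  fibration_of_rlp _ fun _ _ i _ h => by
    have := hτ.corner i f (Or.inl h)
    exact hasLiftingProperty_gap adjF adjM τ i f

-- Right adjoints preserve terminal objects. So for `X ⟶ ⊤` the gap map is `E X ⟶ G X` up to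
-- isomorphism, and the absolute statements follow from the relative ones.
omit hτ in
theorem isIso_snd_terminal (X : C) :
    IsIso (pullback.snd ((conjugateEquiv adjM adjF τ).app (⊤_ C)) (G.map (terminal.from X))) := by
  have := adjM.rightAdjoint_preservesLimits
  have := adjF.rightAdjoint_preservesLimits
  have : IsIso ((conjugateEquiv adjM adjF τ).app (⊤_ C)) :=
    isIso_of_isTerminal (terminalIsTerminal.isTerminalObj E _)
      (terminalIsTerminal.isTerminalObj G _) _
  infer_instance

theorem fibration_conjugate (X : C) [IsFibrant X] :
    Fibration ((conjugateEquiv adjM adjF τ).app X) := by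
  have := isIso_snd_terminal adjF adjM (τ := τ) X
  have := hτ.fibration_gap adjF adjM (terminal.from X)
  rw [← gap_snd _ (terminal.from X)]
  infer_instance

/-- Equivalences at the levels `Q^n` are propagated to the latching objects by induction; the corner
map of each latching map is then a trivial cofibration. -/
theorem hasLiftingProperty_latchingMap_gap {Q : CosimplicialObject D} (hQ : IsReedyCofibrant Q)
    (h : ∀ n : ℕ, WeakEquivalence (τ.app (Q.obj ⦋n⦌))) (n : ℕ) {X Y : C} (f : X ⟶ Y)
    [Fibration f] :
    HasLiftingProperty (latchingMap Q n) (gap (conjugateEquiv adjM adjF τ) f) := by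
  induction n using Nat.strong_induction_on generalizing X Y with
  | h n ih =>
    -- A trivial cofibration is tested against all fibrations, which is why the induction ranges
    -- over all `f` at once.
    obtain ⟨_, _⟩ := trivialCofibration_of_llp (τ.app (latchingObj Q n)) fun X Y f _ => by
      have := hasLiftingProperty_initial_latchingObj Q n (gap (conjugateEquiv adjM adjF τ) f)
        (fun m hm => ih m hm f)
      exact hasLiftingProperty_app_of_initial adjF adjM τ f
    have := hQ n
    have := h n
    have := hτ.cofibration_corner (latchingMap Q n)
    -- Here `pushout.inl` is a pushout of the trivial cofibration `τ.app (latchingObj Q n)`;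
    -- two-out-of-three with `τ.app (Q.obj ⦋n⦌)` applies.
    have := weakEquivalence_of_precomp_of_fac (inl_corner τ (latchingMap Q n))
    exact hasLiftingProperty_gap adjF adjM τ (latchingMap Q n) f

theorem isWeakEquivalence_mappingSpaceMap {Q : CosimplicialObject D} (hQ : IsReedyCofibrant Q)
    (h : ∀ n : ℕ, WeakEquivalence (τ.app (Q.obj ⦋n⦌))) (X : C) [IsFibrant X] :
    IsWeakEquivalence (mappingSpaceMap Q ((conjugateEquiv adjM adjF τ).app X)) := by
  have := isIso_snd_terminal adjF adjM (τ := τ) X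
  have key (n : ℕ) : HasLiftingProperty (latchingMap Q n) ((conjugateEquiv adjM adjF τ).app X) := by
    have := hτ.hasLiftingProperty_latchingMap_gap adjF adjM hQ h n (terminal.from X)
    rw [← gap_snd _ (terminal.from X)]
    infer_instance
  apply isWeakEquivalence_of_rlp
  rintro _ _ _ ⟨n⟩
  have := key n
  exact hasLiftingProperty_mappingSpaceMap Q n _

/-- For a fibration `f` between fibrant objects, the conjugate is a trivial fibration at the target,
hence so is its base change `pullback.snd`. By two-out-of-three the gap map is a trivial fibration,
so `∅ ⟶ A` lifts against it and `τ.app A` lifts against `f`. -/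
theorem weakEquivalence_app
    (h : ∀ (X : C) [IsFibrant X], WeakEquivalence ((conjugateEquiv adjM adjF τ).app X))
    (A : D) [IsCofibrant A] : WeakEquivalence (τ.app A) := by
  have := hτ.left.isCofibrant adjF A
  have := hτ.cofibration_app adjF adjM A
  refine weakEquivalence_of_llp_fibrant _ fun X Y _ _ f _ => ?_
  have := h X
  have := h Y
  have := hτ.fibration_conjugate adjF adjM Y
  have := hτ.fibration_gap adjF adjM f
  have := weakEquivalence_of_postcomp_of_fac (gap_snd (conjugateEquiv adjM adjF τ) f)
  exact hasLiftingProperty_app_of_initial adjF adjM τ f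

end IsLeftQuillenTrans

end Corner

/-! ### Right adjoints of pushouts of left adjoint functors. -/

section PushoutAdjunction

variable {C : Type u₁} [Category.{v₁} C] {D : Type u₂} [Category.{v₂} D]
variable {F₀ F₁ F₂ M : D ⥤ C} {G₀ G₁ G₂ E : C ⥤ D}
  (adj₀ : F₀ ⊣ G₀) (adj₁ : F₁ ⊣ G₁) (adj₂ : F₂ ⊣ G₂)
  {α : F₀ ⟶ F₁} {β : F₀ ⟶ F₂} {inl : F₁ ⟶ M} {inr : F₂ ⟶ M}
  {fst : E ⟶ G₁} {snd : E ⟶ G₂}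

/-- The bijection on morphisms for `adjunctionOfIsPushout`. -/
noncomputable def homEquivOfIsPushout {A : D} {X : C}
    (h : IsPushout (α.app A) (β.app A) (inl.app A) (inr.app A))
    (h' : IsPullback (fst.app X) (snd.app X) ((conjugateEquiv adj₁ adj₀ α).app X)
      ((conjugateEquiv adj₂ adj₀ β).app X)) :
    (M.obj A ⟶ X) ≃ (A ⟶ E.obj X) where
  toFun u := h'.lift (adj₁.homEquiv _ _ (inl.app A ≫ u)) (adj₂.homEquiv _ _ (inr.app A ≫ u)) (by
    rw [← homEquiv_app_comp, ← homEquiv_app_comp, ← Category.assoc, ← Category.assoc, h.w])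
  invFun w := h.desc ((adj₁.homEquiv _ _).symm (w ≫ fst.app X))
    ((adj₂.homEquiv _ _).symm (w ≫ snd.app X)) (by
      apply (adj₀.homEquiv _ _).injective
      rw [homEquiv_app_comp adj₀ adj₁, homEquiv_app_comp adj₀ adj₂, Equiv.apply_symm_apply,
        Equiv.apply_symm_apply, Category.assoc, Category.assoc, h'.w])
  left_inv u := by
    apply h.hom_ext
    · rw [h.inl_desc, h'.lift_fst, Equiv.symm_apply_apply]
    · rw [h.inr_desc, h'.lift_snd, Equiv.symm_apply_apply]
  right_inv w := by
    apply h'.hom_ext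
    · rw [h'.lift_fst, h.inl_desc, Equiv.apply_symm_apply]
    · rw [h'.lift_snd, h.inr_desc, Equiv.apply_symm_apply]

section

variable {A : D} {X : C} (h : IsPushout (α.app A) (β.app A) (inl.app A) (inr.app A))
  (h' : IsPullback (fst.app X) (snd.app X) ((conjugateEquiv adj₁ adj₀ α).app X)
    ((conjugateEquiv adj₂ adj₀ β).app X))

theorem homEquivOfIsPushout_fst (u : M.obj A ⟶ X) :
    homEquivOfIsPushout adj₀ adj₁ adj₂ h h' u ≫ fst.app X = adj₁.homEquiv _ _ (inl.app A ≫ u) :=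
  h'.lift_fst _ _ _

theorem homEquivOfIsPushout_snd (u : M.obj A ⟶ X) :
    homEquivOfIsPushout adj₀ adj₁ adj₂ h h' u ≫ snd.app X = adj₂.homEquiv _ _ (inr.app A ≫ u) :=
  h'.lift_snd _ _ _

theorem inl_homEquivOfIsPushout_symm (w : A ⟶ E.obj X) :
    inl.app A ≫ (homEquivOfIsPushout adj₀ adj₁ adj₂ h h').symm w =
      (adj₁.homEquiv _ _).symm (w ≫ fst.app X) :=
  h.inl_desc _ _ _

theorem inr_homEquivOfIsPushout_symm (w : A ⟶ E.obj X) :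
    inr.app A ≫ (homEquivOfIsPushout adj₀ adj₁ adj₂ h h').symm w =
      (adj₂.homEquiv _ _).symm (w ≫ snd.app X) :=
  h.inr_desc _ _ _

end

/-- A pushout of left adjoint functors is left adjoint to the pullback of the right adjoints. -/
noncomputable def adjunctionOfIsPushout
    (h : ∀ A, IsPushout (α.app A) (β.app A) (inl.app A) (inr.app A))
    (h' : ∀ X, IsPullback (fst.app X) (snd.app X) ((conjugateEquiv adj₁ adj₀ α).app X)
      ((conjugateEquiv adj₂ adj₀ β).app X)) : M ⊣ E :=
  Adjunction.mkOfHomEquiv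
    { homEquiv A X := homEquivOfIsPushout adj₀ adj₁ adj₂ (h A) (h' X)
      homEquiv_naturality_left_symm {A A' X} a w := by
        apply (h A).hom_ext
        · rw [inl_homEquivOfIsPushout_symm, ← Category.assoc, ← NatTrans.naturality,
            Category.assoc, Category.assoc, inl_homEquivOfIsPushout_symm,
            Adjunction.homEquiv_naturality_left_symm]
        · rw [inr_homEquivOfIsPushout_symm, ← Category.assoc, ← NatTrans.naturality,
            Category.assoc, Category.assoc, inr_homEquivOfIsPushout_symm,
            Adjunction.homEquiv_naturality_left_symm]
      homEquiv_naturality_right {A X X'} u f := by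
        apply (h' X').hom_ext
        · rw [homEquivOfIsPushout_fst, Category.assoc, NatTrans.naturality, ← Category.assoc,
            ← Category.assoc, homEquivOfIsPushout_fst, Adjunction.homEquiv_naturality_right]
        · rw [homEquivOfIsPushout_snd, Category.assoc, NatTrans.naturality, ← Category.assoc,
            ← Category.assoc, homEquivOfIsPushout_snd, Adjunction.homEquiv_naturality_right] }

include adj₀ adj₁ adj₂ in
theorem exists_adjunction_pushout [HasPushouts C] [HasPullbacks D] (α : F₀ ⟶ F₁) (β : F₀ ⟶ F₂) :
    ∃ E : C ⥤ D, Nonempty (pushout α β ⊣ E) :=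
  ⟨pullback (conjugateEquiv adj₁ adj₀ α) (conjugateEquiv adj₂ adj₀ β),
    ⟨adjunctionOfIsPushout adj₀ adj₁ adj₂
      (fun A => (IsPushout.of_hasPushout α β).map ((evaluation _ _).obj A))
      (fun X => (IsPullback.of_hasPullback _ _).map ((evaluation _ _).obj X))⟩⟩

end PushoutAdjunction

/-! ### Mapping cylinders of transformations between left Quillen functors. -/

section MappingCylinder

variable {C : Type u₁} [Category.{v₁} C] {D : Type u₂} [Category.{v₂} D]
  [ModelCategory C] [ModelCategory D] {F N H : D ⥤ C}

/-- A functorial cylinder of `F`: two natural transformations `F ⟶ H` which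
together form a relative version of a left Quillen functor. -/
structure IsLeftQuillenCylinder (ι₀ ι₁ : F ⟶ H) : Prop where
  exists_lift {A B : D} (i : A ⟶ B) {X Y : C} (f : X ⟶ Y) [Cofibration i] [Fibration f]
    (h : WeakEquivalence i ∨ WeakEquivalence f) (a₀ a₁ : F.obj B ⟶ X) (c : H.obj A ⟶ X)
    (d : H.obj B ⟶ Y) (h₀ : F.map i ≫ a₀ = ι₀.app A ≫ c) (h₁ : F.map i ≫ a₁ = ι₁.app A ≫ c)
    (hc : c ≫ f = H.map i ≫ d) (h₀' : a₀ ≫ f = ι₀.app B ≫ d) (h₁' : a₁ ≫ f = ι₁.app B ≫ d) :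
    ∃ k : H.obj B ⟶ X, ι₀.app B ≫ k = a₀ ∧ ι₁.app B ≫ k = a₁ ∧ H.map i ≫ k = c ∧ k ≫ f = d

/-- The inclusion of `F` in the mapping cylinder of `θ : F ⟶ N`. -/
theorem isLeftQuillenTrans_mappingCylinder {ι₀ ι₁ : F ⟶ H} (hι : IsLeftQuillenCylinder ι₀ ι₁)
    (hF : IsLeftQuillen F) (hN : IsLeftQuillen N) (θ : F ⟶ N) :
    IsLeftQuillenTrans (ι₁ ≫ pushout.inl ι₀ θ) where
  left := hF
  corner {A B} i X Y f _ _ h :=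
    { sq_hasLift {a b} sq := by
        have hp (A : D) : IsPushout (ι₀.app A) (θ.app A) ((pushout.inl ι₀ θ).app A)
            ((pushout.inr ι₀ θ).app A) :=
          (IsPushout.of_hasPushout ι₀ θ).map ((evaluation _ _).obj A)
        have := hN.lift i f h
        have ha := pushout.condition =≫ a
        have e₁ := pushout.inl _ _ ≫= sq.w
        have e₂ := pushout.inr _ _ ≫= sq.w
        rw [← Category.assoc, ← Category.assoc, inl_corner] at e₁
        rw [← Category.assoc, ← Category.assoc, inr_corner] at e₂
        rw [Category.assoc, Category.assoc] at ha
        obtain ⟨a₁, ha₁⟩ : ∃ a₁, pushout.inl _ _ ≫ a = a₁ := ⟨_, rfl⟩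
        obtain ⟨a₂, ha₂⟩ : ∃ a₂, pushout.inr _ _ ≫ a = a₂ := ⟨_, rfl⟩
        rw [ha₁] at ha e₁
        rw [ha₂] at ha e₂
        rw [NatTrans.comp_app, Category.assoc] at e₁ ha
        -- The lift is found first on the summand `N B`; its restriction along `θ` then prescribes
        -- the `ι₀` end of the lift on `H B`, while the given `a₁` prescribes the `ι₁` end.
        have sqN : CommSq ((pushout.inr ι₀ θ).app A ≫ a₂) (N.map i) f
            ((pushout.inr ι₀ θ).app B ≫ b) := ⟨by
          rw [Category.assoc, e₂, ← Category.assoc, ← Category.assoc, NatTrans.naturality]⟩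
        obtain ⟨g, hg, hg'⟩ : ∃ g, N.map i ≫ g = (pushout.inr ι₀ θ).app A ≫ a₂ ∧
            g ≫ f = (pushout.inr ι₀ θ).app B ≫ b := ⟨sqN.lift, sqN.fac_left, sqN.fac_right⟩
        obtain ⟨k, hk₀, hk₁, hk, hk'⟩ := hι.exists_lift i f h (θ.app B ≫ g) a₁
          ((pushout.inl ι₀ θ).app A ≫ a₂) ((pushout.inl ι₀ θ).app B ≫ b)
          (by rw [← Category.assoc, NatTrans.naturality, Category.assoc, hg, ← Category.assoc,
                ← Category.assoc, (hp A).w])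
          ha
          (by rw [Category.assoc, e₂, ← Category.assoc, ← Category.assoc, NatTrans.naturality])
          (by rw [Category.assoc, hg', ← Category.assoc, ← Category.assoc, (hp B).w])
          e₁
        obtain ⟨l, hl₁, hl₂⟩ : ∃ l, (pushout.inl ι₀ θ).app B ≫ l = k ∧
            (pushout.inr ι₀ θ).app B ≫ l = g :=
          ⟨(hp B).desc k g hk₀, (hp B).inl_desc _ _ _, (hp B).inr_desc _ _ _⟩
        refine ⟨⟨⟨l, ?_, ?_⟩⟩⟩
        · apply pushout.hom_ext
          · rw [← Category.assoc, inl_corner, NatTrans.comp_app, Category.assoc, hl₁, hk₁, ha₁]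
          · rw [← Category.assoc, inr_corner]
            rw [ha₂]
            apply (hp A).hom_ext
            · rw [← Category.assoc, ← NatTrans.naturality, Category.assoc, hl₁, hk]
            · rw [← Category.assoc, ← NatTrans.naturality, Category.assoc, hl₂, hg]
        · apply (hp B).hom_ext
          · rw [← Category.assoc, hl₁, hk']
          · rw [← Category.assoc, hl₂, hg'] }

end MappingCylinder

/-! ### Consequences of the pushout product axiom. -/

section Monoidal

variable {C : Type u} [Category.{v} C] [ModelCategory C] [MonoidalCategory C] [SymmetricCategory C]
  [MonoidalClosed C]

omit [ModelCategory C] in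
theorem isInitial_tensor (A : C) {K : C} (hK : IsInitial K) : Nonempty (IsInitial (K ⊗ A)) :=
  ⟨(hK.isInitialObj (tensorLeft A) _).ofIso (β_ A K)⟩

theorem whiskerRight_coprod (A B Z : C) (u₀ u₁ : B ⊗ A ⟶ Z) :
    ∃ v : (B ⨿ B) ⊗ A ⟶ Z, coprod.inl ▷ A ≫ v = u₀ ∧ coprod.inr ▷ A ≫ v = u₁ := by
  have : PreservesColimits (tensorRight A) :=
    preservesColimits_of_natIso (BraidedCategory.tensorLeftIsoTensorRight A)
  have h := isColimitOfHasBinaryCoproductOfPreservesColimit (tensorRight A) B B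
  exact ⟨h.desc (BinaryCofan.mk u₀ u₁), h.fac (BinaryCofan.mk u₀ u₁) ⟨.left⟩,
    h.fac (BinaryCofan.mk u₀ u₁) ⟨.right⟩⟩

theorem whiskerRight_coprod_hom_ext {A B Z : C} {v w : (B ⨿ B) ⊗ A ⟶ Z}
    (h₀ : coprod.inl ▷ A ≫ v = coprod.inl ▷ A ≫ w) (h₁ : coprod.inr ▷ A ≫ v = coprod.inr ▷ A ≫ w) :
    v = w := by
  have : PreservesColimits (tensorRight A) :=
    preservesColimits_of_natIso (BraidedCategory.tensorLeftIsoTensorRight A)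
  exact BinaryCofan.IsColimit.hom_ext
    (isColimitOfHasBinaryCoproductOfPreservesColimit (tensorRight A) B B) h₀ h₁

omit [MonoidalClosed C] in
theorem weakEquivalence_whiskerLeft_iff {A X Y : C} (f : X ⟶ Y) :
    WeakEquivalence (A ◁ f) ↔ WeakEquivalence (f ▷ A) := by
  rw [weakEquivalence_iff, weakEquivalence_iff]
  refine (weakEquivalences C).arrow_mk_iso_iff (Arrow.isoMk (β_ _ _) (β_ _ _) ?_)
  simp

omit [MonoidalClosed C] in
theorem cofibration_whiskerLeft_iff {A X Y : C} (f : X ⟶ Y) :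
    Cofibration (A ◁ f) ↔ Cofibration (f ▷ A) := by
  rw [cofibration_iff, cofibration_iff]
  refine (cofibrations C).arrow_mk_iso_iff (Arrow.isoMk (β_ _ _) (β_ _ _) ?_)
  simp

variable [MonoidalModelCategory C]

/-- The lifting property of pushout products of cofibrations in terms of the components. -/
theorem exists_lift_pushoutProduct {A A' K K' X Y : C} (i : A ⟶ A') (j : K ⟶ K') (f : X ⟶ Y)
    [hi : Cofibration i] [hj : Cofibration j] [Fibration f]
    (h : (WeakEquivalence i ∨ WeakEquivalence j) ∨ WeakEquivalence f)
    (u : A' ⊗ K ⟶ X) (v : A ⊗ K' ⟶ X) (w : A' ⊗ K' ⟶ Y) (h₁ : i ▷ K ≫ u = A ◁ j ≫ v)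
    (h₂ : u ≫ f = A' ◁ j ≫ w) (h₃ : v ≫ f = i ▷ K' ≫ w) :
    ∃ l : A' ⊗ K' ⟶ X, A' ◁ j ≫ l = u ∧ i ▷ K' ≫ l = v ∧ l ≫ f = w := by
  let P := Functor.PushoutObjObj.ofHasPushout (curriedTensor C) i j
  have hc : Cofibration P.ι := MonoidalModelCategory.cofibration_pushoutProduct i j hi hj
  have : HasLiftingProperty P.ι f := by
    obtain h | h := h
    · have : WeakEquivalence P.ι :=
        MonoidalModelCategory.weakEquivalence_pushoutProduct i j hi hj h
      infer_instance
    · infer_instance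
  have sq : CommSq (P.isPushout.desc u v h₁) P.ι f w := ⟨by
    apply P.isPushout.hom_ext
    · rw [P.isPushout.inl_desc_assoc, h₂, ← Category.assoc, P.inl_ι]; rfl
    · rw [P.isPushout.inr_desc_assoc, h₃, ← Category.assoc, P.inr_ι]; rfl⟩
  refine ⟨sq.lift, ?_, ?_, sq.fac_right⟩
  · have := P.inl ≫= sq.fac_left
    rwa [← Category.assoc, P.inl_ι, P.isPushout.inl_desc] at this
  · have := P.inr ≫= sq.fac_left
    rwa [← Category.assoc, P.inr_ι, P.isPushout.inr_desc] at this

/-- This is the pushout product with `∅ ⟶ B`: the objects `∅ ⊗ K` and `∅ ⊗ K'` are initial. -/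
theorem isLeftQuillen_tensorLeft (B : C) [IsCofibrant B] : IsLeftQuillen (tensorLeft B) where
  lift {K K'} j X Y f _ _ h :=
    { sq_hasLift {u w} sq := by
        obtain ⟨h₁⟩ := isInitial_tensor K (initialIsInitial (C := C))
        obtain ⟨h₂⟩ := isInitial_tensor K' (initialIsInitial (C := C))
        obtain ⟨l, hl₁, -, hl₂⟩ := exists_lift_pushoutProduct (initial.to B) j f
          (h.imp_left Or.inr) u (h₂.to _) w (h₁.hom_ext _ _) sq.w (h₂.hom_ext _ _)
        exact ⟨⟨⟨l, hl₁, hl₂⟩⟩⟩ }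

end Monoidal

/-! ### Quillen pairs, and naturality and unitality of the comonoidal map. -/

section QuillenPairs

variable {C : Type u₁} [Category.{v₁} C] {D : Type u₂} [Category.{v₂} D]
variable {L : D ⥤ C} {R : C ⥤ D} (adj : L ⊣ R)

theorem IsLeftQuillen.comp {B : Type u} [Category.{v} B] [ModelCategory B] [ModelCategory C]
    [ModelCategory D] {F : B ⥤ D} (hF : IsLeftQuillen F) (hL : IsLeftQuillen L) :
    IsLeftQuillen (F ⋙ L) where
  lift i X Y f _ _ h := by
    have := hF.cofibration i
    exact hL.lift (F.map i) f (h.imp_left fun hi => hF.weakEquivalence_of_cofibration i (h := hi))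

variable {adj} in
theorem IsQuillenPair.isLeftQuillen [ModelCategory C] [ModelCategory D]
    (hadj : IsQuillenPair adj) : IsLeftQuillen L where
  lift i X Y f hi hf h := by
    rw [adj.hasLiftingProperty_iff]
    have := hadj.fibration f hf
    obtain h | h := h
    · infer_instance
    · have := hadj.weakEquivalence f hf h
      infer_instance

variable [MonoidalCategory C] [MonoidalCategory D] [R.LaxMonoidal]

theorem homEquiv_comonoidalMap (A B : D) :
    adj.homEquiv _ _ (comonoidalMap adj A B) =
      (adj.unit.app A ⊗ₘ adj.unit.app B) ≫ Functor.LaxMonoidal.μ R (L.obj A) (L.obj B) :=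
  Equiv.apply_symm_apply _ _

theorem comonoidalMap_naturality_right (B : D) {A A' : D} (f : A ⟶ A') :
    L.map (B ◁ f) ≫ comonoidalMap adj B A' = comonoidalMap adj B A ≫ L.obj B ◁ L.map f := by
  apply (adj.homEquiv _ _).injective
  rw [Adjunction.homEquiv_naturality_left, Adjunction.homEquiv_naturality_right,
    homEquiv_comonoidalMap, homEquiv_comonoidalMap, Category.assoc,
    ← Functor.LaxMonoidal.μ_natural_right, ← Category.assoc, ← Category.assoc]
  congr 1
  rw [← id_tensorHom, ← id_tensorHom, MonoidalCategory.tensorHom_comp_tensorHom,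
    MonoidalCategory.tensorHom_comp_tensorHom, Category.id_comp]
  exact congrArg₂ (fun s t => s ⊗ₘ t) (Category.comp_id _).symm (adj.unit.naturality f)

/-- The transpose of right unitality of the lax monoidal functor `R`. -/
theorem comonoidalMap_counitMap (B : D) :
    comonoidalMap adj B (𝟙_ D) ≫ L.obj B ◁ counitMap adj ≫ (ρ_ (L.obj B)).hom =
      L.map (ρ_ B).hom := by
  have h : adj.unit.app (𝟙_ D) ≫ R.map (counitMap adj) = Functor.LaxMonoidal.ε R :=
    (adj.homEquiv_unit ..).symm.trans (Equiv.apply_symm_apply _ _)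
  apply (adj.homEquiv _ _).injective
  rw [Adjunction.homEquiv_naturality_right, homEquiv_comonoidalMap, Adjunction.homEquiv_unit]
  have e : (adj.unit.app B ⊗ₘ adj.unit.app (𝟙_ D)) ≫ R.obj (L.obj B) ◁ R.map (counitMap adj) =
      adj.unit.app B ▷ 𝟙_ D ≫ R.obj (L.obj B) ◁ Functor.LaxMonoidal.ε R := by
    rw [← h, ← id_tensorHom, ← id_tensorHom, ← tensorHom_id,
      MonoidalCategory.tensorHom_comp_tensorHom, MonoidalCategory.tensorHom_comp_tensorHom,
      Category.id_comp]
  rw [R.map_comp, Category.assoc, ← Category.assoc (Functor.LaxMonoidal.μ R _ _),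
    ← Functor.LaxMonoidal.μ_natural_right, Category.assoc, ← Category.assoc, e, Category.assoc,
    ← Functor.LaxMonoidal.right_unitality, rightUnitor_naturality]
  exact adj.unit.naturality (ρ_ B).hom

end QuillenPairs

/-! ### The comonoidal map is a weak equivalence. -/

section Comonoidal

variable {C : Type u₁} [Category.{v₁} C] [ModelCategory C] {D : Type u₂} [Category.{v₂} D]
  [ModelCategory D] {L : D ⥤ C} {R : C ⥤ D} {adj : L ⊣ R}

/-- If the derived counit map is a weak equivalence for one cofibrant replacement, then
it is one for all of them. -/
theorem weakEquivalence_comp_of_isCofibrantReplacement (hL : IsLeftQuillen L) {A : D} {Z : C}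
    (c : L.obj A ⟶ Z) {Q Q' : D} {q : Q ⟶ A} {q' : Q' ⟶ A} (hq : IsCofibrantReplacement q)
    (hq' : IsCofibrantReplacement q') (h : WeakEquivalence (L.map q ≫ c)) :
    WeakEquivalence (L.map q' ≫ c) := by
  have := hq.isCofibrant
  have := hq'.isCofibrant
  have := hq.weakEquivalence
  have := hq'.weakEquivalence
  -- Both `Q` and `Q'` map to `d.Z` over `A` by weak equivalences between cofibrant objects, which
  -- `L` preserves.
  let d := MorphismProperty.factorizationData (cofibrations D) (trivialFibrations D) q
  have : IsCofibrant d.Z := isCofibrant_of_cofibration d.i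
  have : WeakEquivalence d.i := weakEquivalence_of_postcomp_of_fac d.fac
  have sq : CommSq (initial.to d.Z) (initial.to Q') d.p q' := ⟨initialIsInitial.hom_ext _ _⟩
  have : WeakEquivalence sq.lift := weakEquivalence_of_postcomp_of_fac sq.fac_right
  have := hL.weakEquivalence d.i
  have := hL.weakEquivalence sq.lift
  have : WeakEquivalence (L.map d.p ≫ c) :=
    weakEquivalence_of_precomp_of_fac (f := L.map d.i) (fg := L.map q ≫ c)
      (by rw [← Category.assoc, ← L.map_comp, d.fac])
  rw [← sq.fac_right, L.map_comp, Category.assoc]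
  infer_instance

variable [MonoidalCategory D] [SymmetricCategory D] [MonoidalClosed D] [MonoidalModelCategory D]

/-- Tensoring with a cylinder of a cofibrant object gives a functorial cylinder. -/
theorem isLeftQuillenCylinder (hadj : IsQuillenPair adj) {B : D} (P : Cylinder B) [P.IsGood] :
    IsLeftQuillenCylinder
      (Functor.whiskerRight ((curriedTensor D).map P.i₀) L)
      (Functor.whiskerRight ((curriedTensor D).map P.i₁) L) where
  exists_lift {A A'} i X Y f _ hf h a₀ a₁ c d h₀ h₁ hc h₀' h₁' := by
    have := hadj.fibration f hf
    have h' : (WeakEquivalence P.i ∨ WeakEquivalence i) ∨ WeakEquivalence (R.map f) :=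
      h.imp Or.inr (hadj.weakEquivalence f hf)
    -- After transposition to `D`, the two prescribed ends glue to a map on `(B ⨿ B) ⊗ A'`. What
    -- remains is a lifting problem for the pushout product of `i` with `P.i`, a cofibration since
    -- `P` is good.
    obtain ⟨v, hv₀, hv₁⟩ :=
      whiskerRight_coprod A' B _ (adj.homEquiv _ _ a₀) (adj.homEquiv _ _ a₁)
    have e₀ := congrArg (adj.homEquiv (B ⊗ A) X) h₀
    have e₁ := congrArg (adj.homEquiv (B ⊗ A) X) h₁
    have ec := congrArg (adj.homEquiv (P.I ⊗ A) Y) hc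
    have e₀' := congrArg (adj.homEquiv (B ⊗ A') Y) h₀'
    have e₁' := congrArg (adj.homEquiv (B ⊗ A') Y) h₁'
    obtain ⟨l, hl, hlv, hl'⟩ := exists_lift_pushoutProduct P.i i (R.map f) h'
      (adj.homEquiv (P.I ⊗ A) X c) v (adj.homEquiv (P.I ⊗ A') Y d)
      (by
        apply whiskerRight_coprod_hom_ext
        · rw [← Category.assoc, ← comp_whiskerRight, P.inl_i, ← Category.assoc,
            ← whisker_exchange, Category.assoc, hv₀]
          exact (adj.homEquiv_naturality_left _ _).symm.trans
            (e₀.symm.trans (adj.homEquiv_naturality_left _ _))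
        · rw [← Category.assoc, ← comp_whiskerRight, P.inr_i, ← Category.assoc,
            ← whisker_exchange, Category.assoc, hv₁]
          exact (adj.homEquiv_naturality_left _ _).symm.trans
            (e₁.symm.trans (adj.homEquiv_naturality_left _ _)))
      ((adj.homEquiv_naturality_right _ _).symm.trans
        (ec.trans (adj.homEquiv_naturality_left _ _)))
      (by
        apply whiskerRight_coprod_hom_ext
        · rw [← Category.assoc, hv₀, ← Category.assoc, ← comp_whiskerRight, P.inl_i]
          exact (adj.homEquiv_naturality_right _ _).symm.trans
            (e₀'.trans (adj.homEquiv_naturality_left _ _))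
        · rw [← Category.assoc, hv₁, ← Category.assoc, ← comp_whiskerRight, P.inr_i]
          exact (adj.homEquiv_naturality_right _ _).symm.trans
            (e₁'.trans (adj.homEquiv_naturality_left _ _)))
    have hl₀ := coprod.inl ▷ A' ≫= hlv
    have hl₁ := coprod.inr ▷ A' ≫= hlv
    rw [← Category.assoc, ← comp_whiskerRight, P.inl_i, hv₀] at hl₀
    rw [← Category.assoc, ← comp_whiskerRight, P.inr_i, hv₁] at hl₁
    refine ⟨(adj.homEquiv (P.I ⊗ A') X).symm l, ?_, ?_, ?_, ?_⟩
    · exact (adj.homEquiv_naturality_left_symm _ _).symm.trans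
        ((adj.homEquiv _ _).symm_apply_eq.2 hl₀)
    · exact (adj.homEquiv_naturality_left_symm _ _).symm.trans
        ((adj.homEquiv _ _).symm_apply_eq.2 hl₁)
    · exact (adj.homEquiv_naturality_left_symm _ _).symm.trans
        ((adj.homEquiv _ _).symm_apply_eq.2 hl)
    · exact (adj.homEquiv_naturality_right_symm _ _).symm.trans
        ((adj.homEquiv _ _).symm_apply_eq.2 hl')

variable [MonoidalCategory C] [SymmetricCategory C] [MonoidalClosed C] [MonoidalModelCategory C]
  [R.LaxMonoidal]

/-- The comonoidal map as a natural transformation in the second variable. -/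
def comonoidalTrans (adj : L ⊣ R) (B : D) : tensorLeft B ⋙ L ⟶ L ⋙ tensorLeft (L.obj B) where
  app A := comonoidalMap adj B A
  naturality _ _ f := comonoidalMap_naturality_right adj B f

/-- By unitality, the comonoidal map followed by `L B ◁ (L q ≫ counitMap adj)` and the unitor is `L
(B ◁ q ≫ ρ)`. The unit axiom in `C` handles the former factor; the unit axiom in `D`, together with
preservation by `L` of weak equivalences between cofibrant objects, handles the latter map. -/
theorem weakEquivalence_comonoidalMap_of_isCofibrantReplacement (hadj : IsQuillenPair adj) {B : D}
    [IsCofibrant B] {A : D} {q : A ⟶ 𝟙_ D} (hq : IsCofibrantReplacement q)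
    (h : WeakEquivalence (L.map q ≫ counitMap adj)) : WeakEquivalence (comonoidalMap adj B A) := by
  have := hq.isCofibrant
  have hL := hadj.isLeftQuillen
  have := hL.isCofibrant adj B
  have := hL.isCofibrant adj A
  have h₁ : WeakEquivalence (L.obj B ◁ (L.map q ≫ counitMap adj)) :=
    (weakEquivalence_whiskerLeft_iff _).2 (MonoidalModelCategory.unit _ ⟨inferInstance, h⟩ _)
  have h₂ : WeakEquivalence (B ◁ q) :=
    (weakEquivalence_whiskerLeft_iff _).2 (MonoidalModelCategory.unit _ hq _)
  have : IsCofibrant (B ⊗ A) :=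
    (isLeftQuillen_tensorLeft B).isCofibrant (ihom.adjunction B) A
  have := hL.weakEquivalence (B ◁ q ≫ (ρ_ B).hom)
  refine weakEquivalence_of_postcomp_of_fac
    (g := L.obj B ◁ (L.map q ≫ counitMap adj) ≫ (ρ_ (L.obj B)).hom)
    (fg := L.map (B ◁ q ≫ (ρ_ B).hom)) ?_
  rw [MonoidalCategory.whiskerLeft_comp, Category.assoc, ← Category.assoc,
    ← comonoidalMap_naturality_right, Category.assoc, comonoidalMap_counitMap, L.map_comp]

theorem weakEquivalence_comonoidalMap (hadj : IsQuillenPair adj)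
    (hunit : ∀ {Q : D} (q : Q ⟶ 𝟙_ D), IsCofibrantReplacement q →
      WeakEquivalence (L.map q ≫ counitMap adj))
    (hdetect : DetectsWeakEquivalences (𝟙_ D)) (B A : D) [IsCofibrant B] [IsCofibrant A] :
    WeakEquivalence (comonoidalMap adj B A) := by
  obtain ⟨Q, p, hQ, hdet⟩ := hdetect
  have hL := hadj.isLeftQuillen
  have := hL.isCofibrant adj B
  obtain ⟨P, _⟩ := Cylinder.exists_very_good B
  have hF := (isLeftQuillen_tensorLeft B).comp hL
  have hN := hL.comp (isLeftQuillen_tensorLeft (L.obj B))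
  let ι₀ : tensorLeft B ⋙ L ⟶ tensorLeft P.I ⋙ L :=
    Functor.whiskerRight ((curriedTensor D).map P.i₀) L
  let ι₁ : tensorLeft B ⋙ L ⟶ tensorLeft P.I ⋙ L :=
    Functor.whiskerRight ((curriedTensor D).map P.i₁) L
  let π : tensorLeft P.I ⋙ L ⟶ tensorLeft B ⋙ L :=
    Functor.whiskerRight ((curriedTensor D).map P.π) L
  let θ := comonoidalTrans adj B
  have hτ : IsLeftQuillenTrans (ι₁ ≫ pushout.inl ι₀ θ) :=
    isLeftQuillenTrans_mappingCylinder (isLeftQuillenCylinder hadj P) hF hN θ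
  have h₀ : ι₀ ≫ π = 𝟙 _ := by
    ext A
    exact (L.map_comp _ _).symm.trans (by simp [← comp_whiskerRight])
  have h₁ : ι₁ ≫ π = 𝟙 _ := by
    ext A
    exact (L.map_comp _ _).symm.trans (by simp [← comp_whiskerRight])
  -- The projection of the mapping cylinder onto its target.
  let ρ : pushout ι₀ θ ⟶ L ⋙ tensorLeft (L.obj B) := pushout.desc (π ≫ θ) (𝟙 _)
    (by rw [← Category.assoc, h₀, Category.id_comp, Category.comp_id])
  have hfac : (ι₁ ≫ pushout.inl ι₀ θ) ≫ ρ = θ := by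
    rw [Category.assoc, pushout.inl_desc, ← Category.assoc, h₁, Category.id_comp]
  have hfac' (A : D) : (ι₁ ≫ pushout.inl ι₀ θ).app A ≫ ρ.app A = comonoidalMap adj B A :=
    NatTrans.congr_app hfac A
  -- `ρ.app A` is a retraction of `pushout.inr`, which at a cofibrant `A` is a pushout of the
  -- trivial cofibration `ι₀.app A`.
  have hρ (A : D) [IsCofibrant A] : WeakEquivalence (ρ.app A) := by
    have hA := isLeftQuillen_tensorLeft A
    have : Cofibration (P.i₀ ▷ A) := (cofibration_whiskerLeft_iff _).1 (hA.cofibration P.i₀)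
    have : WeakEquivalence (P.i₀ ▷ A) :=
      (weakEquivalence_whiskerLeft_iff _).1 (hA.weakEquivalence_of_cofibration P.i₀)
    have : Cofibration (ι₀.app A) := hL.cofibration (P.i₀ ▷ A)
    have : WeakEquivalence (ι₀.app A) := hL.weakEquivalence_of_cofibration (P.i₀ ▷ A)
    have hp : IsPushout (ι₀.app A) (θ.app A) ((pushout.inl ι₀ θ).app A)
        ((pushout.inr ι₀ θ).app A) :=
      (IsPushout.of_hasPushout ι₀ θ).map ((evaluation _ _).obj A)
    have : WeakEquivalence ((pushout.inr ι₀ θ).app A) :=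
      ((mem_trivialCofibrations_iff _).1 ((trivialCofibrations C).of_isPushout hp.flip
        (mem_trivialCofibrations _))).2
    have : (pushout.inr ι₀ θ).app A ≫ ρ.app A = 𝟙 _ :=
      NatTrans.congr_app (pushout.inr_desc (f := ι₀) (g := θ) _ _ _) A
    exact weakEquivalence_of_precomp_of_fac this
  let adjF := (ihom.adjunction B).comp adj
  obtain ⟨E, ⟨adjM⟩⟩ := exists_adjunction_pushout adjF ((ihom.adjunction P.I).comp adj)
    (adj.comp (ihom.adjunction (L.obj B))) ι₀ θ
  have hQc (n : ℕ) : IsCofibrant (Q.obj ⦋n⦌) :=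
    isCofibrant_obj_of_isReedyCofibrant hQ.reedyCofibrant n
  have hQw (n : ℕ) : WeakEquivalence ((ι₁ ≫ pushout.inl ι₀ θ).app (Q.obj ⦋n⦌)) := by
    have hq : IsCofibrantReplacement (p.app ⦋n⦌ : Q.obj ⦋n⦌ ⟶ 𝟙_ D) :=
      ⟨hQc n, hQ.weakEquivalence n⟩
    have := weakEquivalence_comonoidalMap_of_isCofibrantReplacement hadj (B := B) hq (hunit _ hq)
    have := hQc n
    exact weakEquivalence_of_postcomp_of_fac (hfac' _)
  -- The detection hypothesis enters only here. It concerns maps between fibrant objects, and `E X`,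
  -- `G X` are fibrant because `E` and `G` are right adjoint to left Quillen functors.
  have := hτ.weakEquivalence_app adjF adjM (fun X _ => by
    have := hτ.right.isFibrant adjM X
    have := hF.isFibrant adjF X
    exact (hdet _).2
      (hτ.isWeakEquivalence_mappingSpaceMap adjF adjM hQ.reedyCofibrant hQw X)) A
  rw [← hfac']
  infer_instance

end Comonoidal

end MonoidalQuillen

theorem mainTheorem4
    {C : Type u₁} [Category.{v₁} C] [ModelCategory C]
    [MonoidalCategory C] [SymmetricCategory C] [MonoidalClosed C]
    [MonoidalQuillen.MonoidalModelCategory C]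
    {D : Type u₂} [Category.{v₂} D] [ModelCategory D]
    [MonoidalCategory D] [SymmetricCategory D] [MonoidalClosed D]
    [MonoidalQuillen.MonoidalModelCategory D]
    {L : D ⥤ C} {R : C ⥤ D} (adj : L ⊣ R) (hadj : MonoidalQuillen.IsQuillenPair adj)
    [R.LaxMonoidal]
    (hunit : ∃ (Q : D) (q : Q ⟶ 𝟙_ D), MonoidalQuillen.IsCofibrantReplacement q ∧
      WeakEquivalence (L.map q ≫ MonoidalQuillen.counitMap adj))
    (hdetect : MonoidalQuillen.DetectsWeakEquivalences (𝟙_ D)) :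
    MonoidalQuillen.IsWeakMonoidalQuillenPair adj := by
  obtain ⟨Q₀, q₀, hq₀, h₀⟩ := hunit
  have hunit {Q : D} (q : Q ⟶ 𝟙_ D) (hq : MonoidalQuillen.IsCofibrantReplacement q) :
      WeakEquivalence (L.map q ≫ MonoidalQuillen.counitMap adj) :=
    MonoidalQuillen.weakEquivalence_comp_of_isCofibrantReplacement hadj.isLeftQuillen _ hq₀ hq h₀
  exact
    { toIsQuillenPair := hadj
      comonoidal A B _ _ :=
        MonoidalQuillen.weakEquivalence_comonoidalMap hadj hunit hdetect A B
      unit := hunit }
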